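/- **Setting.** A coin-flipping protocol consists of a finite sequence of quantum messages (each a finite-dimensional register with a prescribed sender, Alice or Bob) and of two honest players. A player has a finite-dimensional private memory in some initial state (the joint initial state is a product state), produces each of its own messages by a quantum channel applied to its memory, absorbs each message of the opponent by a quantum channel, and at the end outputs a bit by a two-outcome projective measurement; output $0$ means that Alice wins and $1$ that Bob wins. The protocol is *fair* if, when both players are honest, their outputs always agree and are uniformly random. $P_A^*$ is the supremum, over all (arbitrary) behaviours of Alice, of the probability that honest Bob outputs $0$; $P_B^*$ is the supremum, over all behaviours of Bob, of the probability that honest Alice outputs $1$. The *bias* is $\epsilon=\max(P_A^*,P_B^*)-\tfrac12$. **The family.** Let $n\ge 2$ and $a_1,\dots,a_n\in[0,1]$, and let $|\phi_i\rangle=\sqrt{a_i}\,|00\rangle+\sqrt{1-a_i}\,|11\rangle$. In the protocol $\mathcal P_n(a_1,\dots,a_n)$ Alice prepares $|\phi_i\rangle$ for odd $i$, Bob for even $i$. For $i=1,\dots,n$, message $i$ consists of one half of $|\phi_i\rangle$, sent by its owner; honest players then share $|\psi\rangle=\bigotimes_i(\sqrt{a_i}|0\rangle_A|0\rangle_B+\sqrt{1-a_i}|1\rangle_A|1\rangle_B)$.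 Let $E_0,E_1$ be the complementary diagonal projectors on $n$ qubits for the following rule: a basis state is read from qubit $n$ down to qubit $1$, and the sender of the first qubit found to be $0$ loses; if all qubits are $1$, Alice wins ($E_0$: Alice wins, $E_1$: Bob wins). Each player measures $\{E_0,E_1\}$ on its $n$ qubits. In message $n+1$ Alice sends all her qubits if she obtained $E_0$ (and outputs $0$), and nothing otherwise; in message $n+2$ Bob sends all his qubits if he obtained $E_1$ (and outputs $1$), and nothing otherwise. If Alice obtained $E_1$ and received $n$ qubits, she measures $\{F_1,I-F_1\}$ on her qubits and those received and outputs $1$ on $F_1$; otherwise she outputs $0$. If Bob obtained $E_0$ and received $n$ qubits, he measures $\{F_0,I-F_0\}$ and outputs $0$ on $F_0$; otherwise he outputs $1$. Here $F_w$ is the orthogonal projection onto the line of $(E_w\otimes E_w)|\psi\rangle$. **The bounds.** For a diagonal matrix let $\mathrm{Tr}_{a_i}$ and $\mathrm{RMS}_{a_i}$ replace each pair of diagonal entries $d_0,d_1$ whose basis states differ only in qubit $i$ (being $0$, respectively $1$, there) by $a_id_0+(1-a_i)d_1$, respectively $\sqrt{a_id_0^2+(1-a_i)d_1^2}$. Put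 $$\alpha=2\left(\mathrm{RMS}_{a_1}\mathrm{Tr}_{a_2}\mathrm{RMS}_{a_3}\mathrm{Tr}_{a_4}\cdots E_0\right)^2,\qquad \beta=2\left(\mathrm{Tr}_{a_1}\mathrm{RMS}_{a_2}\mathrm{Tr}_{a_3}\mathrm{RMS}_{a_4}\cdots E_1\right)^2,$$ where the operations alternate and there is one for each of the $n$ qubits. **Theorem.** There exists a fair quantum coin-flipping protocol with bias strictly less than $1/\sqrt2-1/2$. More precisely, in each of the following cases there are parameters $a_1,\dots,a_n\in[0,1]$ for which $\mathcal P_n(a_1,\dots,a_n)$ is exactly fair, has $n+2$ messages, and satisfies $P_A^*\le\alpha$ and $P_B^*\le\beta$, with the following values. 1. $n=3$ ($5$ messages), each $a_i$ within $10^{-6}$ of $(0.74094,\ 0.479696,\ 0.186312)$: $|\alpha-0.69905|\le 5\cdot10^{-6}$, $|\beta-0.69905|\le 5\cdot 10^{-6}$, and the bias is at most $0.1991$. 2. $n=8$, each $a_i$ within $10^{-6}$ of $(0.680706,\ 0.43281,\ 0.323787,\ 0.264123,\ 0.224377,\ 0.197997,\ 0.177191,\ 0.0834815)$: $|\max(\alpha,\beta)-\tfrac12-0.1931|\le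 5\cdot10^{-5}$; in particular the bias is at most $0.19315$. 3. $n=4$, $n=6$, $n=10$: $|\max(\alpha,\beta)-\tfrac12-\epsilon_n|\le5\cdot10^{-5}$ with $\epsilon_4=0.1957$, $\epsilon_6=0.1937$, $\epsilon_{10}=0.1927$; in particular the bias is at most $\epsilon_n+5\cdot10^{-5}$. -/

import Mathlib

open scoped Matrix Kronecker ComplexOrder

noncomputable section

namespace CoinFlip

/-! ### Two-party quantum protocols -/

/-- The two players. A player's name also serves as an outcome of the coin flip: `alice` is the
outcome zero (Alice wins) and `bob` is the outcome one (Bob wins). -/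
inductive Player
  | alice
  | bob
  deriving DecidableEq

instance : Fintype Player where
  elems := {.alice, .bob}
  complete w := by cases w <;> simp

/-- The opponent. -/
def Player.other : Player → Player
  | .alice => .bob
  | .bob => .alice

/-- A finite-dimensional quantum register, given by the labels of its computational basis. -/
structure Register where
  carrier : Type
  [fintype : Fintype carrier]
  [decEq : DecidableEq carrier]

instance : CoeSort Register Type := ⟨Register.carrier⟩

instance (α : Register) : Fintype α := α.fintype

instance (α : Register) : DecidableEq α := α.decEq

/-- A quantum channel (completely positive trace-preserving map), in Kraus form. -/
structure Channel (α β : Type) [Fintype α] [DecidableEq α] [Fintype β] where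
  ι : Type
  [fintype : Fintype ι]
  kraus : ι → Matrix β α ℂ
  complete : ∑ k, (kraus k)ᴴ * kraus k = 1

section Channel

variable {α β γ : Type} [Fintype α] [DecidableEq α] [Fintype β] [Fintype γ] [DecidableEq γ]

/-- The action of a channel on the left half of a bipartite state. -/
def Channel.onLeft (C : Channel α β) (ρ : Matrix (α × γ) (α × γ) ℂ) :
    Matrix (β × γ) (β × γ) ℂ :=
  letI := C.fintype
  ∑ k, (C.kraus k ⊗ₖ (1 : Matrix γ γ ℂ)) * ρ * (C.kraus k ⊗ₖ (1 : Matrix γ γ ℂ))ᴴ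

/-- The action of a channel on the right half of a bipartite state. -/
def Channel.onRight (C : Channel α β) (ρ : Matrix (γ × α) (γ × α) ℂ) :
    Matrix (γ × β) (γ × β) ℂ :=
  letI := C.fintype
  ∑ k, ((1 : Matrix γ γ ℂ) ⊗ₖ C.kraus k) * ρ * ((1 : Matrix γ γ ℂ) ⊗ₖ C.kraus k)ᴴ

/-- Measure the value of `o` in the computational basis, then apply `|x⟩ ↦ |f x⟩`.
(If `o` is constant, no measurement takes place and the channel is an isometry.) -/
def Channel.measureMap [DecidableEq β] {ω : Type} [Fintype ω] [DecidableEq ω]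
    (o : α → ω) (f : α → β) (hf : ∀ x x', o x = o x' → f x = f x' → x = x') : Channel α β where
  ι := ω
  kraus w := Matrix.of fun y x => if o x = w ∧ y = f x then 1 else 0
  complete := by
    ext x x'
    simp only [Matrix.sum_apply, Matrix.mul_apply, Matrix.conjTranspose_apply, Matrix.of_apply,
      Matrix.one_apply]
    by_cases h : x = x'
    · subst h
      simp [ite_and]
    · rw [if_neg h]
      refine Finset.sum_eq_zero fun w _ => Finset.sum_eq_zero fun y _ => ?_
      by_cases h1 : o x = w ∧ y = f x
      · by_cases h2 : o x' = w ∧ y = f x'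
        · exact absurd (hf x x' (h1.1.trans h2.1.symm) (h1.2.symm.trans h2.2)) h
        · simp [h2]
      · simp [h1]

/-- The isometry `|x⟩ ↦ |f x⟩` of an injective relabelling. -/
def Channel.ofInjective [DecidableEq β] (f : α → β) (hf : Function.Injective f) : Channel α β :=
  Channel.measureMap (fun _ => ()) f fun _ _ _ h => hf h

end Channel

/-- A two-outcome projective measurement, the outcome being the declared winner. -/
structure Measurement (α : Type) [Fintype α] [DecidableEq α] where
  proj : Player → Matrix α α ℂ
  hermitian : ∀ w, (proj w).IsHermitian
  idempotent : ∀ w, proj w * proj w = proj w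
  complete : proj .alice + proj .bob = 1

/-- A message: who sends it, and the register that carries it. -/
structure Message where
  sender : Player
  register : Register

/-- What a player `me` does, from some point of the protocol on, when the messages in the list are
still to be exchanged and the private memory is the second index. A message of `me` is produced by
a channel from the memory to the new memory and the message; a message of the opponent is absorbed
by a channel from the memory and the message to the new memory; after the last message the output
is obtained by a measurement of the memory. -/
inductive Strategy (me : Player) : List Message → Register → Type 1
  | measure {α : Register} (M : Measurement α) : Strategy me [] α
  | send {s : Player} {m : Register} {l : List Message} {α α' : Register} (h : s = me)
      (C : Channel α (α' × m)) (next : Strategy me l α') : Strategy me (⟨s, m⟩ :: l) α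
  | recv {s : Player} {m : Register} {l : List Message} {α α' : Register} (h : s ≠ me)
      (C : Channel (α × m) α') (next : Strategy me l α') : Strategy me (⟨s, m⟩ :: l) α

/-- Handing a message register over from the left player to the right player. -/
def passRight {α β m : Type} (ρ : Matrix ((α × m) × β) ((α × m) × β) ℂ) :
    Matrix (α × (β × m)) (α × (β × m)) ℂ :=
  ρ.submatrix (fun p => ((p.1, p.2.2), p.2.1)) (fun p => ((p.1, p.2.2), p.2.1))

/-- Handing a message register over from the right player to the left player. -/
def passLeft {α β m : Type} (ρ : Matrix (α × (β × m)) (α × (β × m)) ℂ) :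
    Matrix ((α × m) × β) ((α × m) × β) ℂ :=
  ρ.submatrix (fun p => (p.1.1, (p.2, p.1.2))) (fun p => (p.1.1, (p.2, p.1.2)))

/-- The probability that Alice outputs `x` and Bob outputs `y`, when their memories start in the
joint state `ρ` and they follow the given strategies. -/
def run : (l : List Message) → {α β : Register} → Strategy .alice l α → Strategy .bob l β →
    Matrix (α × β) (α × β) ℂ → Player → Player → ℝ
  | [], _, _, .measure M, .measure N, ρ, x, y => ((M.proj x ⊗ₖ N.proj y) * ρ).trace.re
  | _ :: l, _, _, .send _ C A, .recv _ D B, ρ, x, y =>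
      run l A B (D.onRight (passRight (C.onLeft ρ))) x y
  | _ :: l, _, _, .recv _ C A, .send _ D B, ρ, x, y =>
      run l A B (C.onLeft (passLeft (D.onRight ρ))) x y
  | _ :: _, _, _, .send h _ _, .send h' _ _, _, _, _ => nomatch h.symm.trans h'
  | _ :: _, _, _, .recv (s := .alice) h _ _, .recv _ _ _, _, _, _ => absurd rfl h
  | _ :: _, _, _, .recv (s := .bob) _ _ _, .recv h' _ _, _, _, _ => absurd rfl h'

/-- A player together with a private memory, its initial state, and a strategy for the given
sequence of messages. Since a message register is part of the rules, but the memory and all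
operations are arbitrary, these are exactly the possible behaviours of a cheating player. -/
structure Agent (me : Player) (l : List Message) where
  memory : Register
  init : Matrix memory memory ℂ
  posSemidef : init.PosSemidef
  trace_eq_one : init.trace = 1
  strategy : Strategy me l memory

/-- The joint distribution of the outputs; the initial state is unentangled. -/
def outcomeProb {l : List Message} (A : Agent .alice l) (B : Agent .bob l) (x y : Player) : ℝ :=
  run l A.strategy B.strategy (A.init ⊗ₖ B.init) x y

/-- A coin-flipping protocol: the sequence of messages and the honest players. -/
structure Protocol where
  messages : List Message
  alice : Agent .alice messages
  bob : Agent .bob messages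

namespace Protocol

variable (P : Protocol)

/-- When both players are honest, they output the same bit, and it is uniformly random. -/
def IsFair : Prop :=
  ∀ x y, outcomeProb P.alice P.bob x y = if x = y then 1 / 2 else 0

/-- `P_A^*`: the supremum, over everything Alice may do, of the probability that honest Bob
outputs that Alice wins. -/
def cheatAlice : ℝ :=
  sSup {p | ∃ A : Agent .alice P.messages, p = ∑ x, outcomeProb A P.bob x .alice}

/-- `P_B^*`: the supremum, over everything Bob may do, of the probability that honest Alice
outputs that Bob wins. -/
def cheatBob : ℝ :=
  sSup {p | ∃ B : Agent .bob P.messages, p = ∑ y, outcomeProb P.alice B .bob y}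

/-- The bias `max (P_A^*, P_B^*) - 1 / 2`. -/
def bias : ℝ := max P.cheatAlice P.cheatBob - 1 / 2

end Protocol

/-! ### The family of protocols

The parameters are `a 1, …, a n`; bit strings `x : Fin n → Fin 2` have `x i` for the qubit of
message `i + 1`. -/

/-- One qubit. -/
abbrev qubit : Register := ⟨Fin 2⟩

/-- `k` qubits. -/
abbrev qubits (k : ℕ) : Register := ⟨Fin k → Fin 2⟩

/-- Either `k` qubits, or nothing. -/
abbrev qubitsOrNothing (k : ℕ) : Register := ⟨Option (Fin k → Fin 2)⟩

/-- The sender of message `i`. -/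
def sender (i : ℕ) : Player := if Odd i then .alice else .bob

/-- The amplitudes of `√a |00⟩ + √(1 - a) |11⟩`. -/
def phi (a : unitInterval) (p : Fin 2 × Fin 2) : ℂ :=
  if p = (0, 0) then (√(a : ℝ) : ℝ) else if p = (1, 1) then (√(1 - (a : ℝ)) : ℝ) else 0

/-- The amplitudes of the state `ψ` that the honest players share after the first `n` messages. -/
def psi (a : ℕ → unitInterval) (n : ℕ) (p : qubits n × qubits n) : ℂ :=
  ∏ i : Fin n, phi (a (i + 1)) (p.1 i, p.2 i)

/-- The outcome of `{E_0, E_1}` on a basis state: the qubits are examined from the last to the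
first, and the sender of the first one found to be zero loses; if all are one, Alice wins. -/
def winner : (n : ℕ) → (Fin n → Fin 2) → Player
  | 0, _ => .alice
  | n + 1, x => if x (Fin.last n) = 0 then (sender (n + 1)).other else winner n (Fin.init x)

/-- The diagonal of the projector `E_w` onto the basis states with winner `w`. -/
def E (w : Player) (n : ℕ) (x : Fin n → Fin 2) : ℝ := if winner n x = w then 1 else 0

/-- The vector `(E_w ⊗ E_w) ψ`. -/
def checkVec (a : ℕ → unitInterval) (w : Player) (n : ℕ) (p : qubits n × qubits n) : ℂ :=
  E w n p.1 * E w n p.2 * psi a n p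

/-- The same vector on the memory of a player who checks the opponent: the first component holds
the player's own qubits (`none` if they were sent away), the second the opponent's message. -/
def checkVecMem (a : ℕ → unitInterval) (w : Player) (n : ℕ) :
    qubitsOrNothing n × qubitsOrNothing n → ℂ
  | (some x, some y) => checkVec a w n (x, y)
  | _ => 0

/-- The orthogonal projection `|v⟩⟨v| / ⟨v|v⟩` onto the line of a vector. -/
def lineProj {α : Type} [Fintype α] (v : α → ℂ) : Matrix α α ℂ :=
  (v ⬝ᵥ star v)⁻¹ • Matrix.vecMulVec v (star v)

theorem lineProj_isHermitian {α : Type} [Fintype α] (v : α → ℂ) : (lineProj v).IsHermitian := by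
  have h : star (v ⬝ᵥ star v) = v ⬝ᵥ star v := (Matrix.dotProduct_star v v).symm
  ext i j
  simp only [lineProj, Matrix.conjTranspose_apply, Matrix.smul_apply, Matrix.vecMulVec_apply,
    smul_eq_mul, star_mul', star_inv₀, h, Pi.star_apply, star_star]
  ring

theorem lineProj_idempotent {α : Type} [Fintype α] (v : α → ℂ) :
    lineProj v * lineProj v = lineProj v := by
  rw [lineProj, Matrix.smul_mul, Matrix.mul_smul, Matrix.vecMulVec_mul_vecMulVec,
    dotProduct_comm (star v) v]
  by_cases h : v ⬝ᵥ star v = 0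
  · simp [h]
  · rw [Matrix.vecMulVec_smul, smul_smul, smul_smul, mul_assoc,
      inv_mul_cancel₀ h, mul_one]

/-- The final measurement of a player whose opponent is `w`. The outcome is `w` exactly if the
player still has its own qubits (so that `{E_0, E_1}` gave `w`), has received the `n` qubits of
`w`, and finds them in the state `(E_w ⊗ E_w) ψ`, normalized. In all other cases the player
declares itself the winner. -/
def finalMeasurement (a : ℕ → unitInterval) (w : Player) (n : ℕ) :
    Measurement (qubitsOrNothing n × qubitsOrNothing n) where
  proj w' := if w' = w then lineProj (checkVecMem a w n) else 1 - lineProj (checkVecMem a w n)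
  hermitian w' := by
    split_ifs
    · exact lineProj_isHermitian _
    · exact Matrix.isHermitian_one.sub (lineProj_isHermitian _)
  idempotent w' := by
    split_ifs
    · exact lineProj_idempotent _
    · simp [sub_mul, mul_sub, lineProj_idempotent]
  complete := by
    cases w <;> simp

/-- The messages that remain after `k` qubits were sent, when `j` more are to be sent, first by `p`,
then by `q`, and so on in turn; then come the two messages of the cheat detection. -/
def messagesFrom (p q : Player) (k : ℕ) : ℕ → List Message
  | 0 => [⟨.alice, qubitsOrNothing k⟩, ⟨.bob, qubitsOrNothing k⟩]
  | j + 1 => ⟨p, qubit⟩ :: messagesFrom q p (k + 1) j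

/-- The register of the pairs of qubits that a player has prepared and not yet used, when `j`
qubits are still to be sent; the flag tells whether the next one is sent by this player. -/
def unsent : ℕ → Bool → Register
  | 0, _ => ⟨Unit⟩
  | j + 1, true => ⟨(Fin 2 × Fin 2) × unsent j false⟩
  | j + 1, false => unsent j true

/-- The amplitudes of `φ_i ⊗ φ_{i+2} ⊗ ⋯` on that register, `k` qubits having been sent. -/
def unsentState (a : ℕ → unitInterval) : (j : ℕ) → (mine : Bool) → (k : ℕ) → unsent j mine → ℂ
  | 0, _, _, _ => 1
  | j + 1, true, k, u => phi (a (k + 1)) u.1 * unsentState a j false (k + 1) u.2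
  | j + 1, false, k, u => unsentState a j true (k + 1) u

theorem phi_norm (a : unitInterval) : ∑ p, phi a p * star (phi a p) = 1 := by
  have h0 : (0 : ℝ) ≤ a := a.2.1
  have h1 : (0 : ℝ) ≤ 1 - a := sub_nonneg.2 a.2.2
  simp only [phi, Fintype.sum_prod_type, Fin.sum_univ_two]
  simp [← Complex.ofReal_mul, Real.mul_self_sqrt h0, Real.mul_self_sqrt h1]

theorem unsentState_norm (a : ℕ → unitInterval) : ∀ (j : ℕ) (mine : Bool) (k : ℕ),
    ∑ u, unsentState a j mine k u * star (unsentState a j mine k u) = 1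
  | 0, _, _ => by
    change ∑ u : Unit, (1 : ℂ) * star 1 = 1
    simp
  | j + 1, false, k => unsentState_norm a j true (k + 1)
  | j + 1, true, k => by
    change ∑ u : (Fin 2 × Fin 2) × unsent j false,
      (phi (a (k + 1)) u.1 * unsentState a j false (k + 1) u.2) *
        star (phi (a (k + 1)) u.1 * unsentState a j false (k + 1) u.2) = 1
    rw [Fintype.sum_prod_type]
    calc _ = ∑ p, ∑ u, (phi (a (k + 1)) p * star (phi (a (k + 1)) p)) *
          (unsentState a j false (k + 1) u * star (unsentState a j false (k + 1) u)) := by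
          refine Finset.sum_congr rfl fun p _ => Finset.sum_congr rfl fun u _ => ?_
          rw [star_mul']
          ring
      _ = 1 := by
          rw [← Finset.sum_mul_sum, phi_norm, unsentState_norm a j false (k + 1), one_mul]

/-- The memory during the first `n` messages: the halves that are kept or were received, one for
each of the `k` messages so far, and the pairs that are not yet used. -/
abbrev stage (k j : ℕ) (mine : Bool) : Register := ⟨qubits k × unsent j mine⟩

/-- The first `n` messages: send one half of the next prepared pair and keep the other one, or
receive a qubit. -/
def exchange {me opp : Player} (h : opp ≠ me)
    (finish : ∀ (k : ℕ) (mine : Bool), Strategy me (messagesFrom .alice .bob k 0) (stage k 0 mine)) :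
    (j k : ℕ) → (mine : Bool) →
      Strategy me (messagesFrom (cond mine me opp) (cond mine opp me) k j) (stage k j mine)
  | 0, k, mine => finish k mine
  | j + 1, k, true =>
      .send rfl
        (Channel.ofInjective
          (fun p : qubits k × ((Fin 2 × Fin 2) × unsent j false) =>
            (((Fin.snoc p.1 p.2.1.1 : Fin (k + 1) → Fin 2), p.2.2), p.2.1.2))
          (by
            rintro ⟨x, ⟨b, c⟩, u⟩ ⟨x', ⟨b', c'⟩, u'⟩ hx
            simp only [Prod.mk.injEq, Fin.snoc_inj] at hx
            obtain ⟨⟨⟨rfl, rfl⟩, rfl⟩, rfl⟩ := hx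
            rfl))
        (exchange h finish j (k + 1) false)
  | j + 1, k, false =>
      .recv h
        (Channel.ofInjective
          (fun p : (qubits k × unsent j true) × qubit =>
            ((Fin.snoc p.1.1 p.2 : Fin (k + 1) → Fin 2), p.1.2))
          (by
            rintro ⟨⟨x, u⟩, c⟩ ⟨⟨x', u'⟩, c'⟩ hx
            obtain ⟨h1, h2⟩ := Prod.mk.inj hx
            obtain ⟨rfl, rfl⟩ := Fin.snoc_inj.1 h1
            obtain rfl : u = u' := h2
            rfl))
        (exchange h finish j (k + 1) true)

/-- Alice's part of the cheat detection: she measures `{E_0, E_1}` and sends all her qubits if she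
won, nothing otherwise; then she receives Bob's message and performs the final measurement. -/
def aliceFinish (a : ℕ → unitInterval) (k : ℕ) (mine : Bool) :
    Strategy .alice (messagesFrom .alice .bob k 0) (stage k 0 mine) :=
  .send (α' := qubitsOrNothing k) rfl
    (Channel.measureMap (fun p : qubits k × Unit => winner k p.1)
      (fun p => if winner k p.1 = .alice then (none, some p.1) else (some p.1, none))
      (by
        rintro ⟨x, _⟩ ⟨x', _⟩ ho hf
        simp only at ho hf
        rw [ho] at hf
        refine Prod.ext ?_ (Subsingleton.elim (α := Unit) _ _)
        split_ifs at hf <;> simp_all))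
    (.recv (α' := ⟨qubitsOrNothing k × qubitsOrNothing k⟩) (by decide)
      (Channel.ofInjective id Function.injective_id)
      (.measure (finalMeasurement a .bob k)))

/-- Bob's part of the cheat detection: he receives Alice's message, measures `{E_0, E_1}` on his
own qubits and sends them all if he won, nothing otherwise; then he performs the final
measurement. -/
def bobFinish (a : ℕ → unitInterval) (k : ℕ) (mine : Bool) :
    Strategy .bob (messagesFrom .alice .bob k 0) (stage k 0 mine) :=
  .recv (α' := ⟨(qubits k × Unit) × qubitsOrNothing k⟩) (by decide)
    (Channel.ofInjective id Function.injective_id)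
    (.send (α' := ⟨qubitsOrNothing k × qubitsOrNothing k⟩) rfl
      (Channel.measureMap (fun p : (qubits k × Unit) × qubitsOrNothing k => winner k p.1.1)
        (fun p => if winner k p.1.1 = .bob then ((none, p.2), some p.1.1)
          else ((some p.1.1, p.2), none))
        (by
          rintro ⟨⟨x, _⟩, m⟩ ⟨⟨x', _⟩, m'⟩ ho hf
          simp only at ho hf
          rw [ho] at hf
          split_ifs at hf <;> simp_all))
      (.measure (finalMeasurement a .alice k)))

/-- An honest player, who starts with all of its pairs `φ_i` prepared. -/
def honest {me : Player} {l : List Message} (a : ℕ → unitInterval) (n : ℕ) (mine : Bool)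
    (s : Strategy me l (stage 0 n mine)) : Agent me l where
  memory := stage 0 n mine
  init := Matrix.vecMulVec (fun p => unsentState a n mine 0 p.2)
    (star fun p => unsentState a n mine 0 p.2)
  posSemidef := Matrix.posSemidef_vecMulVec_self_star _
  trace_eq_one := by
    rw [Matrix.trace_vecMulVec]
    change ∑ p : (Fin 0 → Fin 2) × unsent n mine,
      unsentState a n mine 0 p.2 * star (unsentState a n mine 0 p.2) = 1
    rw [Fintype.sum_prod_type]
    simpa using unsentState_norm a n mine 0
  strategy := s

/-- The weak coin-flipping protocol with parameters `a 1, …, a n`. -/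
def protocol (n : ℕ) (a : ℕ → unitInterval) : Protocol where
  messages := messagesFrom .alice .bob 0 n
  alice := honest a n true (exchange (opp := .bob) (by decide) (aliceFinish a) n 0 true)
  bob := honest a n false (exchange (opp := .alice) (by decide) (bobFinish a) n 0 false)

/-! ### The bounds -/

/-- The weighted partial trace over the last qubit of a diagonal matrix. -/
def traceLast (a : ℝ) {n : ℕ} (d : (Fin (n + 1) → Fin 2) → ℝ) (x : Fin n → Fin 2) : ℝ :=
  a * d (Fin.snoc x 0) + (1 - a) * d (Fin.snoc x 1)

/-- The weighted root mean square over the last qubit of a diagonal matrix. -/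
def rmsLast (a : ℝ) {n : ℕ} (d : (Fin (n + 1) → Fin 2) → ℝ) (x : Fin n → Fin 2) : ℝ :=
  √(a * d (Fin.snoc x 0) ^ 2 + (1 - a) * d (Fin.snoc x 1) ^ 2)

/-- The nested operation on a diagonal matrix on `n` qubits that applies, from qubit `n` to
qubit `1`, the weighted trace to the qubits sent by the honest player `h` and the weighted root mean
square to the others. -/
def nested (a : ℕ → unitInterval) (h : Player) : (n : ℕ) → ((Fin n → Fin 2) → ℝ) → ℝ
  | 0, d => d Fin.elim0
  | n + 1, d => nested a h n
      (if sender (n + 1) = h then traceLast (a (n + 1)) d else rmsLast (a (n + 1)) d)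

/-- `α = 2 (RMS_{a_1} Tr_{a_2} RMS_{a_3} ⋯ E_0)²`. -/
def boundAlice (n : ℕ) (a : ℕ → unitInterval) : ℝ := 2 * nested a .bob n (E .alice n) ^ 2

/-- `β = 2 (Tr_{a_1} RMS_{a_2} Tr_{a_3} ⋯ E_1)²`. -/
def boundBob (n : ℕ) (a : ℕ → unitInterval) : ℝ := 2 * nested a .alice n (E .bob n) ^ 2

/-- The protocol with parameters `a 1, …, a n` is a weak coin-flipping protocol with `n + 2`
messages; `α` and `β` bound the success of cheating; and the bound `max (α, β) - 1 / 2` on the bias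
that they give equals `ε` up to an error of at most `δ`. -/
def Achieves (n : ℕ) (a : ℕ → unitInterval) (ε δ : ℝ) : Prop :=
  (protocol n a).messages.length = n + 2 ∧
  (protocol n a).IsFair ∧
  (protocol n a).cheatAlice ≤ boundAlice n a ∧
  (protocol n a).cheatBob ≤ boundBob n a ∧
  |max (boundAlice n a) (boundBob n a) - 1 / 2 - ε| ≤ δ

end CoinFlip

end

open scoped Matrix Kronecker ComplexOrder

set_option linter.unusedSectionVars false

noncomputable section

namespace CoinFlip

/-! ### Channels acting on one half of a bipartite state -/

section Channels

variable {α β γ : Type} [Fintype α] [DecidableEq α] [Fintype β] [Fintype γ] [DecidableEq γ]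

attribute [instance] Channel.fintype

/-! Let `c` cheat against the honest player `h`. Up to the cheat detection the joint state has the
form `withPure ρ U`: `U` is the product of the pairs that `h` has not used yet, and `ρ` is shared
between the memory of `c` and the qubits held by `h`. The bound needs only the distribution `t` of
the basis states of those qubits. Operations of `c` alone cannot change it (`traceLeft_onLeft`).

The final test projects onto the line of `v = (E_c ⊗ E_c) ψ`. For a positive semidefinite `R` each
entry obeys `|R p q| ≤ √(R p p) √(R q q)`, so the double sum `⟨v|R|v⟩ / ⟨v|v⟩` is at most `(∑ x, E_c
x √(p x) √(t x))² / P_c`, with `p` the honest distribution and `P_c` the honest winning probability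
of `c` (`trace_lineProj_le`). This overlap is then pulled back one qubit at a time. If `h` sent the
last qubit, its distribution is forced, and summing it out averages the weights
(`overlap_of_honest`). If `c` sent it, only the marginal on the earlier qubits is fixed, and
Cauchy–Schwarz replaces the weights by their root mean square (`overlap_le_of_cheat`). After all `n`
qubits the overlap has become the number `nested`; `duel_exchange_le` is this induction. With `P_c =
1/2` the bounds are `α` and `β`.

For honest players every step acts on pure states. The matching basis states of `ψ` make both obtain
the same winner, and the surviving branch passes the test with certainty (`run_finish`,
`run_exchange`). Fairness is therefore the single equation `winProb a .alice n = 1 / 2`, which is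
affine in `a 1` and is solved exactly by a rational number.

The numerical values are tractable because every diagonal met on the way depends only on the winner:
two numbers, of which one changes at each qubit. They are enclosed in rational intervals
(`NestedMem`). -/

theorem Channel.onLeft_apply (C : Channel α β) (ρ : Matrix (α × γ) (α × γ) ℂ) (p q : β × γ) :
    C.onLeft ρ p q =
      ∑ k, ∑ i, ∑ j, C.kraus k p.1 i * ρ (i, p.2) (j, q.2) * star (C.kraus k q.1 j) := by
  simp only [Channel.onLeft, Matrix.sum_apply, Matrix.mul_apply, Matrix.conjTranspose_apply,
    Matrix.kroneckerMap_apply, Fintype.sum_prod_type, Matrix.one_apply, mul_ite, mul_one, mul_zero,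
    ite_mul, zero_mul, Finset.sum_ite_eq, Finset.mem_univ, if_true, Finset.sum_mul, star_zero,
    apply_ite star]
  refine Finset.sum_congr rfl fun k _ => ?_
  rw [Finset.sum_comm]

theorem Channel.onRight_apply (C : Channel α β) (ρ : Matrix (γ × α) (γ × α) ℂ) (p q : γ × β) :
    C.onRight ρ p q =
      ∑ k, ∑ i, ∑ j, C.kraus k p.2 i * ρ (p.1, i) (q.1, j) * star (C.kraus k q.2 j) := by
  simp only [Channel.onRight, Matrix.sum_apply, Matrix.mul_apply, Matrix.conjTranspose_apply,
    Matrix.kroneckerMap_apply, Fintype.sum_prod_type_right, Matrix.one_apply, ite_mul,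
    one_mul, zero_mul, mul_zero, mul_ite,
    Finset.sum_ite_eq, Finset.mem_univ, if_true, Finset.sum_mul, star_zero,
    apply_ite star]
  refine Finset.sum_congr rfl fun k _ => ?_
  rw [Finset.sum_comm]

/-- Exchanging the two halves of a bipartite state. -/
def swapState (ρ : Matrix (α × γ) (α × γ) ℂ) : Matrix (γ × α) (γ × α) ℂ :=
  ρ.submatrix Prod.swap Prod.swap

/-- Together with its mirror image this allows the cheater to be placed on the left whichever player
it is, so that the bound is proved once. -/
theorem Channel.onLeft_swapState (C : Channel α β) (ρ : Matrix (γ × α) (γ × α) ℂ) :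
    C.onLeft (swapState ρ) = swapState (C.onRight ρ) := by
  ext p q
  simp [swapState, Channel.onLeft_apply, Channel.onRight_apply]

theorem Channel.onRight_swapState (C : Channel α β) (ρ : Matrix (α × γ) (α × γ) ℂ) :
    C.onRight (swapState ρ) = swapState (C.onLeft ρ) := by
  ext p q
  simp [swapState, Channel.onLeft_apply, Channel.onRight_apply]

/-- The partial trace over the left half. -/
def traceLeft (ρ : Matrix (α × γ) (α × γ) ℂ) : Matrix γ γ ℂ :=
  Matrix.of fun x y => ∑ i, ρ (i, x) (i, y)

theorem traceLeft_apply (ρ : Matrix (α × γ) (α × γ) ℂ) (x y : γ) :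
    traceLeft ρ x y = ∑ i, ρ (i, x) (i, y) := rfl

/-- When the cheater's outcome is ignored its measurement contributes the identity, and the honest
outcome sees only the reduced state. -/
theorem trace_one_kronecker_mul (N : Matrix γ γ ℂ) (ρ : Matrix (α × γ) (α × γ) ℂ) :
    (((1 : Matrix α α ℂ) ⊗ₖ N) * ρ).trace = (N * traceLeft ρ).trace := by
  simp only [Matrix.trace, Matrix.diag, Matrix.mul_apply, Matrix.kroneckerMap_apply,
    Fintype.sum_prod_type, traceLeft_apply, Finset.mul_sum]
  rw [Finset.sum_comm]
  refine Finset.sum_congr rfl fun x _ => ?_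
  rw [Finset.sum_comm]
  conv_lhs => rw [Finset.sum_comm]
  conv_rhs => rw [Finset.sum_comm]
  refine Finset.sum_congr rfl fun i _ => ?_
  rw [Finset.sum_eq_single i]
  · simp
  · intro j _ hj
    simp [Matrix.one_apply_ne hj.symm]
  · simp

theorem trace_swapState_mul (M : Matrix (γ × α) (γ × α) ℂ) (ρ : Matrix (α × γ) (α × γ) ℂ) :
    (swapState M * ρ).trace = (M * swapState ρ).trace := by
  simp only [Matrix.trace, Matrix.diag, Matrix.mul_apply, swapState, Matrix.submatrix_apply]
  rw [← (Equiv.prodComm α γ).sum_comp]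
  refine Finset.sum_congr rfl fun p _ => ?_
  rw [← (Equiv.prodComm α γ).sum_comp]
  rfl

/-- No signalling: inside the partial trace the Kraus operators recombine to `∑ Kᴴ K = 1`. Besides
positivity and locality, nothing else about a cheater's channels enters the bound. -/
theorem traceLeft_onLeft (C : Channel α β) (ρ : Matrix (α × γ) (α × γ) ℂ) :
    traceLeft (C.onLeft ρ) = traceLeft ρ := by
  ext x y
  have h (i j : α) : ∑ k, ∑ b, star (C.kraus k b j) * C.kraus k b i = if j = i then 1 else 0 := by
    have := congrFun₂ C.complete j i
    simpa [Matrix.sum_apply, Matrix.mul_apply, Matrix.one_apply] using this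
  simp only [traceLeft_apply, Channel.onLeft_apply]
  calc _ = ∑ i, ∑ j, (∑ k, ∑ b, star (C.kraus k b j) * C.kraus k b i) * ρ (i, x) (j, y) := by
        simp only [Finset.sum_mul]
        rw [Finset.sum_comm]
        conv_lhs => enter [2, k]; rw [Finset.sum_comm]; enter [2, i]; rw [Finset.sum_comm]
        rw [Finset.sum_comm]
        refine Finset.sum_congr rfl fun i _ => ?_
        rw [Finset.sum_comm]
        refine Finset.sum_congr rfl fun j _ => Finset.sum_congr rfl fun k _ =>
          Finset.sum_congr rfl fun b _ => ?_
        ring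
    _ = _ := by
        simp only [h, ite_mul, one_mul, zero_mul, Finset.sum_ite_eq', Finset.mem_univ, if_true]

theorem Channel.onLeft_posSemidef [Finite β] (C : Channel α β) {ρ : Matrix (α × γ) (α × γ) ℂ}
    (h : ρ.PosSemidef) : (C.onLeft ρ).PosSemidef :=
  Matrix.posSemidef_sum _ fun _ _ => h.mul_mul_conjTranspose_same _

theorem Channel.onRight_posSemidef (C : Channel α β) {ρ : Matrix (γ × α) (γ × α) ℂ}
    (h : ρ.PosSemidef) : (C.onRight ρ).PosSemidef :=
  Matrix.posSemidef_sum _ fun _ _ => h.mul_mul_conjTranspose_same _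

theorem traceLeft_posSemidef {ρ : Matrix (α × γ) (α × γ) ℂ} (h : ρ.PosSemidef) :
    (traceLeft ρ).PosSemidef := by
  have : traceLeft ρ = ∑ i, ρ.submatrix (Prod.mk i) (Prod.mk i) := by
    ext x y
    simp [traceLeft_apply, Matrix.sum_apply]
  rw [this]
  exact Matrix.posSemidef_sum _ fun _ _ => h.submatrix _

variable [DecidableEq β] {ω : Type} [Fintype ω] [DecidableEq ω]

/-- An injective `f` gives each label in its range a single preimage, so the only effect apart from
relabelling is the loss of coherence between different outcomes. -/
theorem Channel.measureMap_onRight_apply {o : α → ω} {f : α → β}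
    (hf : ∀ x x', o x = o x' → f x = f x' → x = x') (hf' : f.Injective)
    (ρ : Matrix (γ × α) (γ × α) ℂ) (g g' : γ) (x x' : α) :
    (Channel.measureMap o f hf).onRight ρ (g, f x) (g', f x') =
      if o x = o x' then ρ (g, x) (g', x') else 0 := by
  rw [Channel.onRight_apply]
  change ∑ w : ω, ∑ i, ∑ j, (if o i = w ∧ f x = f i then 1 else 0) * ρ (g, i) (g', j) *
    star (if o j = w ∧ f x' = f j then (1 : ℂ) else 0) = _
  have hs (w : ω) (i j : α) : (if o i = w ∧ f x = f i then 1 else 0) * ρ (g, i) (g', j) *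
      star (if o j = w ∧ f x' = f j then (1 : ℂ) else 0) =
      if x = i then if x' = j then if o x = w then if o x' = w then ρ (g, x) (g', x') else 0
        else 0 else 0 else 0 := by
    simp only [hf'.eq_iff]
    split_ifs <;> simp_all
  simp only [hs]
  simp [eq_comm]

theorem Channel.ofInjective_onRight_apply {f : α → β} (hf : f.Injective)
    (ρ : Matrix (γ × α) (γ × α) ℂ) (g g' : γ) (x x' : α) :
    (Channel.ofInjective f hf).onRight ρ (g, f x) (g', f x') = ρ (g, x) (g', x') := by
  rw [Channel.ofInjective, Channel.measureMap_onRight_apply _ hf, if_pos rfl]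

theorem Channel.measureMap_onLeft_apply {o : α → ω} {f : α → β}
    (hf : ∀ x x', o x = o x' → f x = f x' → x = x') (hf' : f.Injective)
    (ρ : Matrix (α × γ) (α × γ) ℂ) (g g' : γ) (x x' : α) :
    (Channel.measureMap o f hf).onLeft ρ (f x, g) (f x', g') =
      if o x = o x' then ρ (x, g) (x', g') else 0 := by
  have := Channel.measureMap_onRight_apply hf hf' (swapState ρ) g g' x x'
  rwa [Channel.onRight_swapState] at this

end Channels

/-! ### A cheater against an honest player -/

theorem Player.eq_of_ne {c h s : Player} (hne : c ≠ h) (hs : s ≠ c) : s = h := by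
  cases c <;> cases h <;> cases s <;> trivial

theorem alice_ne_bob : Player.alice ≠ Player.bob := by decide

/-- The probability that the player `h` outputs `y` against the player `c`, whose half of the
joint state comes first and whose own output is ignored. -/
def duel {c h : Player} (hne : c ≠ h) : (l : List Message) → {α β : Register} → Strategy c l α →
    Strategy h l β → Matrix (α × β) (α × β) ℂ → Player → ℝ
  | [], _, _, .measure _, .measure N, ρ, y => (N.proj y * traceLeft ρ).trace.re
  | _ :: l, _, _, .send _ C A, .recv _ D B, ρ, y =>
      duel hne l A B (D.onRight (passRight (C.onLeft ρ))) y
  | _ :: l, _, _, .recv _ C A, .send _ D B, ρ, y =>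
      duel hne l A B (C.onLeft (passLeft (D.onRight ρ))) y
  | _ :: _, _, _, .send h _ _, .send h' _ _, _, _ => absurd (h.symm.trans h') hne
  | _ :: _, _, _, .recv h _ _, .recv h' _ _, _, _ =>
      absurd (Player.eq_of_ne hne h) h'

/-- With arbitrary strategies and registers, this and the next equation can be applied up to
unfolding of `messagesFrom` and `exchange`. -/
theorem duel_send_recv {c h s : Player} (hne : c ≠ h) {m : Register} {l : List Message}
    {α α' β β' : Register} (hs : s = c) (C : Channel α (α' × m)) (A : Strategy c l α') (hs' : s ≠ h)
    (D : Channel (β × m) β') (B : Strategy h l β') (ρ : Matrix (α × β) (α × β) ℂ) (y : Player) :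
    duel hne (⟨s, m⟩ :: l) (.send hs C A) (.recv hs' D B) ρ y =
      duel hne l A B (D.onRight (passRight (C.onLeft ρ))) y := by
  simp only [duel]

theorem duel_recv_send {c h s : Player} (hne : c ≠ h) {m : Register} {l : List Message}
    {α α' β β' : Register} (hs : s ≠ c) (C : Channel (α × m) α') (A : Strategy c l α') (hs' : s = h)
    (D : Channel β (β' × m)) (B : Strategy h l β') (ρ : Matrix (α × β) (α × β) ℂ) (y : Player) :
    duel hne (⟨s, m⟩ :: l) (.recv hs C A) (.send hs' D B) ρ y =
      duel hne l A B (C.onLeft (passLeft (D.onRight ρ))) y := by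
  simp only [duel]

theorem sum_run_alice {l : List Message} {α β : Register} (A : Strategy .alice l α)
    (B : Strategy .bob l β) (ρ : Matrix (α × β) (α × β) ℂ) (y : Player) :
    ∑ x, run l A B ρ x y = duel alice_ne_bob l A B ρ y := by
  induction l generalizing α β with
  | nil =>
    cases A with | measure M => cases B with | measure N =>
    simp only [run, duel]
    have hM : ∑ x, M.proj x = 1 := by
      rw [← M.complete]
      exact Finset.sum_pair alice_ne_bob
    rw [← Complex.re_sum, ← Matrix.trace_sum, ← Finset.sum_mul, ← trace_one_kronecker_mul]
    congr 3
    rw [← hM]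
    ext p q
    simp [Matrix.sum_apply, Finset.sum_mul]
  | cons _ l ih =>
    cases A with
    | send h C A =>
      cases B with
      | send h' D B => exact nomatch h.symm.trans h'
      | recv h' D B => simp only [run, duel]; exact ih _ _ _
    | recv h C A =>
      cases B with
      | send h' D B => simp only [run, duel]; exact ih _ _ _
      | recv h' D B => exact absurd (Player.eq_of_ne alice_ne_bob h) h'

/-- The cheater now sits on the right; exchanging the halves at every message turns each channel and
each handover into its mirror image. -/
theorem sum_run_bob {l : List Message} {α β : Register} (A : Strategy .alice l α)
    (B : Strategy .bob l β) (ρ : Matrix (α × β) (α × β) ℂ) (x : Player) :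
    ∑ y, run l A B ρ x y = duel alice_ne_bob.symm l B A (swapState ρ) x := by
  induction l generalizing α β with
  | nil =>
    cases A with | measure M => cases B with | measure N =>
    simp only [run, duel]
    have hN : ∑ y, N.proj y = 1 := by
      rw [← N.complete]
      exact Finset.sum_pair alice_ne_bob
    rw [← Complex.re_sum, ← Matrix.trace_sum, ← Finset.sum_mul, ← trace_one_kronecker_mul]
    have : ∑ y, M.proj x ⊗ₖ N.proj y = swapState ((1 : Matrix β β ℂ) ⊗ₖ M.proj x) := by
      rw [← hN]
      ext p q
      simp [swapState, Matrix.sum_apply, Finset.mul_sum, mul_comm]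
    rw [this, trace_swapState_mul]
  | cons _ l ih =>
    cases A with
    | send h C A =>
      cases B with
      | send h' D B => exact nomatch h.symm.trans h'
      | recv h' D B =>
        simp only [run, duel]
        rw [ih, ← Channel.onLeft_swapState, Channel.onRight_swapState]
        rfl
    | recv h C A =>
      cases B with
      | send h' D B =>
        simp only [run, duel]
        rw [ih, ← Channel.onRight_swapState, Channel.onLeft_swapState]
        rfl
      | recv h' D B => exact absurd (Player.eq_of_ne alice_ne_bob h) h'

/-! ### The exchange of the qubits against a cheater -/

section Product

variable {α β γ δ : Type} [Fintype α] [DecidableEq α] [Fintype β] [DecidableEq β] [Fintype γ]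
  [DecidableEq γ] [Fintype δ] {k : ℕ}

/-- The state `ρ ⊗ |U⟩⟨U|`, where the register of `U` belongs to the right player. -/
def withPure (ρ : Matrix (α × β) (α × β) ℂ) (U : γ → ℂ) :
    Matrix (α × (β × γ)) (α × (β × γ)) ℂ :=
  Matrix.of fun p q => ρ (p.1, p.2.1) (q.1, q.2.1) * (U p.2.2 * star (U q.2.2))

/-- The cheater has no access to pairs that were never sent, so the product form of the state
survives its operations. -/
theorem Channel.onLeft_withPure (C : Channel α δ) (ρ : Matrix (α × β) (α × β) ℂ) (U : γ → ℂ) :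
    C.onLeft (withPure ρ U) = withPure (C.onLeft ρ) U := by
  ext p q
  simp only [Channel.onLeft_apply, withPure, Matrix.of_apply, Finset.sum_mul]
  refine Finset.sum_congr rfl fun k _ => Finset.sum_congr rfl fun i _ =>
    Finset.sum_congr rfl fun j _ => ?_
  ring

/-- The state after the right player has appended a received qubit to its `k` qubits. -/
def absorbQubit (ρ : Matrix ((α × Fin 2) × (Fin k → Fin 2)) ((α × Fin 2) × (Fin k → Fin 2)) ℂ) :
    Matrix (α × (Fin (k + 1) → Fin 2)) (α × (Fin (k + 1) → Fin 2)) ℂ :=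
  ρ.submatrix (fun p => ((p.1, p.2 (Fin.last k)), Fin.init p.2))
    (fun p => ((p.1, p.2 (Fin.last k)), Fin.init p.2))

/-- The state after the right player has given away one half of a pair `φ` and has appended the
other half to its `k` qubits. -/
def emitQubit (a : unitInterval) (ρ : Matrix (α × (Fin k → Fin 2)) (α × (Fin k → Fin 2)) ℂ) :
    Matrix ((α × Fin 2) × (Fin (k + 1) → Fin 2)) ((α × Fin 2) × (Fin (k + 1) → Fin 2)) ℂ :=
  Matrix.of fun p q => ρ (p.1.1, Fin.init p.2) (q.1.1, Fin.init q.2) *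
    (phi a (p.2 (Fin.last k), p.1.2) * star (phi a (q.2 (Fin.last k), q.1.2)))

theorem absorbQubit_posSemidef
    {ρ : Matrix ((α × Fin 2) × (Fin k → Fin 2)) ((α × Fin 2) × (Fin k → Fin 2)) ℂ}
    (h : ρ.PosSemidef) : (absorbQubit ρ).PosSemidef :=
  h.submatrix _

theorem emitQubit_posSemidef (a : unitInterval)
    {ρ : Matrix (α × (Fin k → Fin 2)) (α × (Fin k → Fin 2)) ℂ} (h : ρ.PosSemidef) :
    (emitQubit a ρ).PosSemidef := by
  -- The new state is the old one, pulled back along the forgetful map, conjugated by the diagonal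
  -- matrix of the amplitudes of `φ`.
  have := (h.submatrix fun p : (α × Fin 2) × (Fin (k + 1) → Fin 2) =>
    (p.1.1, (Fin.init p.2 : Fin k → Fin 2))).mul_mul_conjTranspose_same
      (Matrix.diagonal fun p : (α × Fin 2) × (Fin (k + 1) → Fin 2) =>
        phi a (p.2 (Fin.last k), p.1.2))
  convert this using 1
  ext p q
  simp only [emitQubit, Matrix.of_apply, Matrix.diagonal_conjTranspose, Matrix.mul_diagonal,
    Matrix.diagonal_mul, Matrix.submatrix_apply, Pi.star_apply]
  ring

theorem onRight_passRight_withPure {f : ((Fin k → Fin 2) × γ) × Fin 2 → (Fin (k + 1) → Fin 2) × γ}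
    (hf : f.Injective) (hf' : ∀ p, f p = (Fin.snoc p.1.1 p.2, p.1.2))
    (ρ : Matrix ((α × Fin 2) × (Fin k → Fin 2)) ((α × Fin 2) × (Fin k → Fin 2)) ℂ) (U : γ → ℂ)
    {σ : Matrix ((α × Fin 2) × ((Fin k → Fin 2) × γ)) ((α × Fin 2) × ((Fin k → Fin 2) × γ)) ℂ}
    (hσ : σ = withPure ρ U) :
    (Channel.ofInjective f hf).onRight (passRight σ) = withPure (absorbQubit ρ) U := by
  subst hσ
  ext ⟨i, x, u⟩ ⟨j, y, w⟩
  have h (x : Fin (k + 1) → Fin 2) (u : γ) : (x, u) = f ((Fin.init x, u), x (Fin.last k)) := by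
    simp [hf']
  rw [h x u, h y w, Channel.ofInjective_onRight_apply, ← h, ← h]
  rfl

theorem passLeft_onRight_withPure
    {f : (Fin k → Fin 2) × ((Fin 2 × Fin 2) × γ) → ((Fin (k + 1) → Fin 2) × γ) × Fin 2}
    (hf : f.Injective) (hf' : ∀ p, f p = ((Fin.snoc p.1 p.2.1.1, p.2.2), p.2.1.2))
    (a : unitInterval) (ρ : Matrix (α × (Fin k → Fin 2)) (α × (Fin k → Fin 2)) ℂ) (U : γ → ℂ)
    {V : (Fin 2 × Fin 2) × γ → ℂ} (hV : ∀ u, V u = phi a u.1 * U u.2) :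
    passLeft ((Channel.ofInjective f hf).onRight (withPure ρ V)) = withPure (emitQubit a ρ) U := by
  ext ⟨⟨i, c⟩, x, u⟩ ⟨⟨j, d⟩, y, w⟩
  have h (x : Fin (k + 1) → Fin 2) (u : γ) (c : Fin 2) :
      ((x, u), c) = f (Fin.init x, (x (Fin.last k), c), u) := by
    simp [hf']
  change (Channel.ofInjective f hf).onRight (withPure ρ V) (i, ((x, u), c)) (j, ((y, w), d)) = _
  rw [h x u c, h y w d, Channel.ofInjective_onRight_apply]
  simp only [withPure, emitQubit, Matrix.of_apply, hV, star_mul']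
  ring

/-- The probability of the basis state `x` when the right player measures its half. -/
def diagRight (ρ : Matrix (α × β) (α × β) ℂ) (x : β) : ℝ := (traceLeft ρ x x).re

theorem diagRight_nonneg {ρ : Matrix (α × β) (α × β) ℂ} (h : ρ.PosSemidef) (x : β) :
    0 ≤ diagRight ρ x := by
  have := (traceLeft_posSemidef h).diag_nonneg (i := x)
  exact (Complex.le_def.1 this).1

/-- The only constraint retained for a cheater who sends a qubit: the earlier bits keep their
distribution. -/
theorem sum_diagRight_absorbQubit
    (ρ : Matrix ((α × Fin 2) × (Fin k → Fin 2)) ((α × Fin 2) × (Fin k → Fin 2)) ℂ)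
    (x : Fin k → Fin 2) :
    diagRight (absorbQubit ρ) (Fin.snoc x 0) + diagRight (absorbQubit ρ) (Fin.snoc x 1) =
      diagRight ρ x := by
  simp only [diagRight, traceLeft_apply, absorbQubit, Matrix.submatrix_apply, Fin.snoc_last,
    Fin.init_snoc, Fintype.sum_prod_type, Fin.sum_univ_two, Finset.sum_add_distrib, Complex.add_re]

/-- The weights of `0` and `1` in the state `φ`. -/
def bitProb (a : ℝ) : Fin 2 → ℝ := ![a, 1 - a]

theorem bitProb_nonneg (a : unitInterval) (b : Fin 2) : 0 ≤ bitProb a b := by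
  fin_cases b
  · exact a.2.1
  · exact sub_nonneg.2 a.2.2

theorem phi_apply (a : unitInterval) (b c : Fin 2) :
    phi a (b, c) = if b = c then ((√(bitProb a b) : ℝ) : ℂ) else 0 := by
  fin_cases b <;> fin_cases c <;> simp [phi, bitProb]

/-- After the half that left is traced out, the kept bit is independent of the earlier ones and has
its honest distribution, whatever the cheater did before. -/
theorem diagRight_emitQubit (a : unitInterval)
    (ρ : Matrix (α × (Fin k → Fin 2)) (α × (Fin k → Fin 2)) ℂ) (x : Fin k → Fin 2) (b : Fin 2) :
    diagRight (emitQubit a ρ) (Fin.snoc x b) = bitProb a b * diagRight ρ x := by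
  have h : ∑ c, phi a (b, c) * star (phi a (b, c)) = (bitProb a b : ℂ) := by
    simp only [phi_apply, apply_ite star, star_zero, mul_ite, ite_mul, zero_mul, mul_zero]
    simp [← Complex.ofReal_mul, Real.mul_self_sqrt (bitProb_nonneg a b)]
  simp only [diagRight, traceLeft_apply, emitQubit, Matrix.of_apply, Fin.snoc_last,
    Fin.init_snoc, Fintype.sum_prod_type, ← Finset.mul_sum, h]
  rw [← Finset.sum_mul, mul_comm, Complex.re_ofReal_mul]

end Product

/-! ### Overlaps with the honest distribution -/

/-- The probability of the bit string `x` when the honest state is measured. -/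
def stringProb (a : ℕ → unitInterval) (k : ℕ) (x : Fin k → Fin 2) : ℝ :=
  ∏ i : Fin k, bitProb (a (i + 1)) (x i)

theorem stringProb_nonneg (a : ℕ → unitInterval) (k : ℕ) (x : Fin k → Fin 2) :
    0 ≤ stringProb a k x :=
  Finset.prod_nonneg fun _ _ => bitProb_nonneg _ _

theorem stringProb_snoc (a : ℕ → unitInterval) (k : ℕ) (x : Fin k → Fin 2) (b : Fin 2) :
    stringProb a (k + 1) (Fin.snoc x b) = stringProb a k x * bitProb (a (k + 1)) b := by
  simp [stringProb, Fin.prod_univ_castSucc]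

theorem sum_snoc {M : Type*} [AddCommMonoid M] (k : ℕ) (f : (Fin (k + 1) → Fin 2) → M) :
    ∑ x, f x = ∑ x : Fin k → Fin 2, (f (Fin.snoc x 0) + f (Fin.snoc x 1)) := by
  rw [← (Fin.snocEquiv fun _ : Fin (k + 1) => Fin 2).sum_comp, Fintype.sum_prod_type_right]
  simp [Fin.snocEquiv, Fin.sum_univ_two]

/-- The overlap of the distribution `t` with the honest one, weighted by `d`. -/
def overlap (a : ℕ → unitInterval) (k : ℕ) (d t : (Fin k → Fin 2) → ℝ) : ℝ :=
  ∑ x, d x * (√(stringProb a k x) * √(t x))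

theorem overlap_nonneg (a : ℕ → unitInterval) {k : ℕ} {d : (Fin k → Fin 2) → ℝ} (hd : ∀ x, 0 ≤ d x)
    (t : (Fin k → Fin 2) → ℝ) : 0 ≤ overlap a k d t :=
  Finset.sum_nonneg fun x _ => mul_nonneg (hd x) (by positivity)

/-- Both distributions acquire the same factor `bitProb`, and its two square roots multiply back to
the probability itself; summing out the bit therefore averages the weights. -/
theorem overlap_of_honest (a : ℕ → unitInterval) {k : ℕ} (d : (Fin (k + 1) → Fin 2) → ℝ)
    {t' : (Fin (k + 1) → Fin 2) → ℝ} {t : (Fin k → Fin 2) → ℝ}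
    (h : ∀ x b, t' (Fin.snoc x b) = bitProb (a (k + 1)) b * t x) :
    overlap a (k + 1) d t' = overlap a k (traceLast (a (k + 1)) d) t := by
  rw [overlap, sum_snoc]
  refine Finset.sum_congr rfl fun x _ => ?_
  have h' (b : Fin 2) : √(stringProb a (k + 1) (Fin.snoc x b)) * √(t' (Fin.snoc x b)) =
      bitProb (a (k + 1)) b * (√(stringProb a k x) * √(t x)) := by
    rw [h, stringProb_snoc, Real.sqrt_mul (stringProb_nonneg _ _ _),
      Real.sqrt_mul (bitProb_nonneg _ _)]
    linear_combination (√(stringProb a k x) * √(t x)) *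
      Real.mul_self_sqrt (bitProb_nonneg (a (k + 1)) b)
  rw [h', h', traceLast]
  simp only [bitProb, Matrix.cons_val_zero, Matrix.cons_val_one]
  ring

theorem overlap_le_of_cheat (a : ℕ → unitInterval) {k : ℕ} (d : (Fin (k + 1) → Fin 2) → ℝ)
    {t' : (Fin (k + 1) → Fin 2) → ℝ} {t : (Fin k → Fin 2) → ℝ} (ht : ∀ x, 0 ≤ t' x)
    (h : ∀ x, t' (Fin.snoc x 0) + t' (Fin.snoc x 1) = t x) :
    overlap a (k + 1) d t' ≤ overlap a k (rmsLast (a (k + 1)) d) t := by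
  rw [overlap, sum_snoc]
  refine Finset.sum_le_sum fun x _ => ?_
  rw [stringProb_snoc, stringProb_snoc, Real.sqrt_mul (stringProb_nonneg _ _ _),
    Real.sqrt_mul (stringProb_nonneg _ _ _), rmsLast, ← h x]
  have h0 := bitProb_nonneg (a (k + 1)) 0
  have h1 := bitProb_nonneg (a (k + 1)) 1
  have h0' := Real.sq_sqrt h0
  have h1' := Real.sq_sqrt h1
  have e : (a (k + 1) : ℝ) * d (Fin.snoc x 0) ^ 2 + (1 - a (k + 1)) * d (Fin.snoc x 1) ^ 2 =
      (√(bitProb (a (k + 1)) 0) * d (Fin.snoc x 0)) ^ 2 +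
      (√(bitProb (a (k + 1)) 1) * d (Fin.snoc x 1)) ^ 2 := by
    rw [mul_pow, mul_pow, h0', h1']
    rfl
  rw [e]
  have hs0 := Real.sq_sqrt (ht (Fin.snoc x 0))
  have hs1 := Real.sq_sqrt (ht (Fin.snoc x 1))
  set p := √(bitProb (a (k + 1)) 0) * d (Fin.snoc x 0)
  set q := √(bitProb (a (k + 1)) 1) * d (Fin.snoc x 1)
  set r := √(t' (Fin.snoc x 0))
  set s := √(t' (Fin.snoc x 1))
  rw [← hs0, ← hs1]
  -- Cauchy–Schwarz in the plane: the defect of the squares is `(p s - q r)²`. The first factor is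
  -- the root mean square of the weights, the second is `√(t x)`.
  have key : p * r + q * s ≤ √(p ^ 2 + q ^ 2) * √(r ^ 2 + s ^ 2) := by
    rw [← Real.sqrt_mul (by positivity)]
    exact Real.le_sqrt_of_sq_le (by nlinarith [sq_nonneg (p * s - q * r)])
  calc _ = √(stringProb a k x) * (p * r + q * s) := by ring
    _ ≤ √(stringProb a k x) * (√(p ^ 2 + q ^ 2) * √(r ^ 2 + s ^ 2)) := by gcongr
    _ = _ := by ring

theorem sender_succ_ne (k : ℕ) : sender (k + 2) ≠ sender (k + 1) := by
  unfold sender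
  by_cases h : Odd (k + 1)
  · rw [if_pos h, if_neg (by simpa [parity_simps] using h)]
    decide
  · rw [if_neg h, if_pos (by simpa [parity_simps] using h)]
    decide

/-- Induction on the number `j` of qubits still to come, over all memories, strategies and states of
the cheater. `D k` is what remains of the final weights after qubits `n, …, k + 1` have been
eliminated. The flag `mine` has to agree with the sender of message `k + 1`, since it decides which
of the two overlap lemmas applies. -/
theorem duel_exchange_le {c h : Player} (hne : c ≠ h) (a : ℕ → unitInterval) {n : ℕ} {w : Player}
    {K : ℝ} (hK : 0 ≤ K) (D : ∀ k, (Fin k → Fin 2) → ℝ) (hD0 : ∀ k x, 0 ≤ D k x)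
    (hD : ∀ k < n, D k = if sender (k + 1) = h then traceLast (a (k + 1)) (D (k + 1))
      else rmsLast (a (k + 1)) (D (k + 1)))
    (finish : ∀ (k : ℕ) (mine : Bool), Strategy h (messagesFrom .alice .bob k 0) (stage k 0 mine))
    (hfin : ∀ (mine : Bool) (α : Register) (s : Strategy c (messagesFrom .alice .bob n 0) α)
      (ρ : Matrix (α × (Fin n → Fin 2)) (α × (Fin n → Fin 2)) ℂ), ρ.PosSemidef →
      duel hne _ s (finish n mine) (withPure ρ (unsentState a 0 mine n)) w ≤
        K * overlap a n (D n) (diagRight ρ) ^ 2) :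
    ∀ (j k : ℕ) (mine : Bool), k + j = n → (sender (k + 1) = h ↔ mine = true) →
      ∀ (α : Register) (s : Strategy c (messagesFrom (cond mine h c) (cond mine c h) k j) α)
        (ρ : Matrix (α × (Fin k → Fin 2)) (α × (Fin k → Fin 2)) ℂ), ρ.PosSemidef →
        duel hne _ s (exchange hne finish j k mine) (withPure ρ (unsentState a j mine k)) w ≤
          K * overlap a k (D k) (diagRight ρ) ^ 2
  | 0, k, mine, hkn, hmine, α, s, ρ, hρ => by
    obtain rfl : k = n := by simpa using hkn
    exact hfin mine α s ρ hρ
  | j + 1, k, true, hkn, hmine, α, s, ρ, hρ => by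
    cases s with
    | send hs C A => exact absurd hs.symm hne
    | recv hs C A =>
      have ih := duel_exchange_le hne a hK D hD0 hD finish hfin j (k + 1) false (by omega)
        (by
          have h1 := hmine.2 rfl
          simpa [h1] using sender_succ_ne k) _ A (C.onLeft (emitQubit (a (k + 1)) ρ))
        (C.onLeft_posSemidef (emitQubit_posSemidef _ hρ))
      have hDk := hD k (by omega)
      rw [if_pos (hmine.2 rfl)] at hDk
      have hov : overlap a (k + 1) (D (k + 1))
          (diagRight (C.onLeft (emitQubit (a (k + 1)) ρ))) = overlap a k (D k) (diagRight ρ) := by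
        rw [hDk]
        refine overlap_of_honest a _ fun x b => ?_
        rw [← diagRight_emitQubit]
        simp only [diagRight, traceLeft_onLeft]
      rw [← Channel.onLeft_withPure, hov] at ih
      refine le_trans (le_of_eq ?_) ih
      refine (duel_recv_send hne hs C A rfl _ _ _ w).trans
        (congrArg (fun σ => duel hne _ A (exchange hne finish j (k + 1) false) (C.onLeft σ) w) ?_)
      exact passLeft_onRight_withPure (γ := unsent j false) _ (fun _ => rfl) _ _ _ fun _ => rfl
  | j + 1, k, false, hkn, hmine, α, s, ρ, hρ => by
    cases s with
    | recv hs C A => exact absurd rfl hs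
    | send hs C A =>
      have hs' : sender (k + 1) ≠ h := fun h1 => by simpa using hmine.1 h1
      have ih := duel_exchange_le hne a hK D hD0 hD finish hfin j (k + 1) true (by omega)
        (by
          have h1 := Player.eq_of_ne hne.symm hs'
          have h2 := sender_succ_ne k
          rw [h1] at h2
          simpa using Player.eq_of_ne hne h2) _ A (absorbQubit (C.onLeft ρ))
        (absorbQubit_posSemidef (C.onLeft_posSemidef hρ))
      have hDk := hD k (by omega)
      rw [if_neg hs'] at hDk
      have hov : overlap a (k + 1) (D (k + 1)) (diagRight (absorbQubit (C.onLeft ρ))) ≤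
          overlap a k (D k) (diagRight ρ) := by
        rw [hDk]
        refine overlap_le_of_cheat a _
          (diagRight_nonneg (absorbQubit_posSemidef (C.onLeft_posSemidef hρ))) fun x => ?_
        rw [sum_diagRight_absorbQubit]
        simp only [diagRight, traceLeft_onLeft]
      -- Needed to square the inequality between the overlaps.
      have h0 := overlap_nonneg a (hD0 (k + 1)) (diagRight (absorbQubit (C.onLeft ρ)))
      refine le_trans (le_of_eq ?_) (ih.trans (by gcongr))
      refine (duel_send_recv hne hs C A _ _ _ _ w).trans
        (congrArg (fun σ => duel hne _ A (exchange hne finish j (k + 1) true) σ w) ?_)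
      exact onRight_passRight_withPure (γ := unsent j true) _ (fun _ => rfl) _ _
        (C.onLeft_withPure _ _)

/-! ### The cheat detection -/

theorem psi_apply (a : ℕ → unitInterval) (n : ℕ) (x y : Fin n → Fin 2) :
    psi a n (x, y) = if x = y then ((√(stringProb a n x) : ℝ) : ℂ) else 0 := by
  simp only [psi, phi_apply]
  split_ifs with h
  · subst h
    simp only [if_true, stringProb]
    rw [Real.sqrt_prod _ fun i _ => bitProb_nonneg _ _, Complex.ofReal_prod]
  · obtain ⟨i, hi⟩ := Function.ne_iff.1 h
    exact Finset.prod_eq_zero (Finset.mem_univ i) (if_neg hi)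

/-- The probability that the player `w` wins when both players are honest. -/
def winProb (a : ℕ → unitInterval) (w : Player) (n : ℕ) : ℝ := ∑ x, E w n x * stringProb a n x

theorem E_nonneg (w : Player) (n : ℕ) (x : Fin n → Fin 2) : 0 ≤ E w n x := by
  unfold E
  split_ifs <;> norm_num

/-- The labels of the memory of a player at the final measurement. -/
abbrev CheckMem (n : ℕ) : Type := Option (Fin n → Fin 2) × Option (Fin n → Fin 2)

theorem checkVecMem_some (a : ℕ → unitInterval) (w : Player) (n : ℕ) (x y : Fin n → Fin 2) :
    checkVecMem a w n ((some x, some y) : CheckMem n) =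
      if x = y then ((E w n x * √(stringProb a n x) : ℝ) : ℂ) else 0 := by
  change (E w n x : ℂ) * E w n y * psi a n (x, y) = _
  rw [psi_apply]
  split_ifs with h
  · subst h
    have : (E w n x : ℂ) * E w n x = E w n x := by
      unfold E
      split_ifs <;> simp
    rw [this]
    push_cast
    rfl
  · simp

theorem sum_checkVecMem_mul (a : ℕ → unitInterval) (w : Player) (n : ℕ)
    (g : CheckMem n → ℂ) :
    ∑ p : CheckMem n, checkVecMem a w n p * g p =
      ∑ x, ((E w n x * √(stringProb a n x) : ℝ) : ℂ) * g (some x, some x) := by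
  rw [Fintype.sum_prod_type]
  have h0 (y : Option (Fin n → Fin 2)) : checkVecMem a w n ((none, y) : CheckMem n) = 0 := rfl
  have h1 (x : Fin n → Fin 2) : checkVecMem a w n ((some x, none) : CheckMem n) = 0 := rfl
  simp only [Fintype.sum_option, h0, h1, checkVecMem_some]
  simp

theorem star_checkVecMem (a : ℕ → unitInterval) (w : Player) (n : ℕ) :
    star (checkVecMem a w n) = checkVecMem a w n := by
  ext ⟨x, y⟩
  rcases x with _ | x <;> rcases y with _ | y <;> try simp [checkVecMem]
  change star (checkVecMem a w n ((some x, some y) : CheckMem n)) =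
    checkVecMem a w n ((some x, some y) : CheckMem n)
  rw [checkVecMem_some]
  split_ifs <;> simp

/-- The normalization of the final test is the honest winning probability; for a fair protocol its
inverse is the factor 2 in `α` and `β`. -/
theorem checkVecMem_dotProduct_self (a : ℕ → unitInterval) (w : Player) (n : ℕ) :
    checkVecMem a w n ⬝ᵥ star (checkVecMem a w n) = (winProb a w n : ℂ) := by
  rw [star_checkVecMem, dotProduct, sum_checkVecMem_mul, winProb, Complex.ofReal_sum]
  refine Finset.sum_congr rfl fun x _ => ?_
  rw [checkVecMem_some, if_pos rfl, ← Complex.ofReal_mul]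
  congr 1
  have : E w n x * E w n x = E w n x := by
    unfold E
    split_ifs <;> simp
  linear_combination (√(stringProb a n x) * √(stringProb a n x)) * this +
    E w n x * Real.mul_self_sqrt (stringProb_nonneg a n x)

/-- The principal minor on the rows `p` and `q` is nonnegative. -/
theorem norm_apply_le_of_posSemidef {β : Type} [Fintype β] [DecidableEq β]
    {R : Matrix β β ℂ} (hR : R.PosSemidef) (p q : β) : ‖R p q‖ ≤ √(R p p).re * √(R q q).re := by
  have h := (hR.submatrix ![p, q]).det_nonneg
  have hp := (Complex.le_def.1 (hR.diag_nonneg (i := p))).1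
  have hpi := (Complex.le_def.1 (hR.diag_nonneg (i := p))).2
  have hq := (Complex.le_def.1 (hR.diag_nonneg (i := q))).1
  rw [← Real.sqrt_mul hp]
  refine Real.le_sqrt_of_sq_le ?_
  rw [Matrix.det_fin_two] at h
  simp only [Matrix.submatrix_apply, Matrix.cons_val_zero, Matrix.cons_val_one] at h
  rw [← hR.1.apply q p] at h
  have := (Complex.le_def.1 h).1
  simp at this hpi
  rw [← hpi] at this
  rw [Complex.sq_norm, Complex.normSq_apply]
  linarith

theorem trace_lineProj_mul {β : Type} [Fintype β] (v : β → ℂ) (R : Matrix β β ℂ) :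
    (lineProj v * R).trace = (v ⬝ᵥ star v)⁻¹ * ∑ p, v p * ∑ q, star (v q) * R q p := by
  rw [lineProj, Matrix.smul_mul, Matrix.trace_smul, smul_eq_mul]
  congr 1
  simp only [Matrix.trace, Matrix.diag, Matrix.mul_apply, Matrix.vecMulVec_apply, Finset.mul_sum,
    Pi.star_apply, mul_assoc]

/-- The check vector lives on the labels `(some x, some x)`. Bounding every entry of `R` between
them by diagonal entries makes the double sum a perfect square. The comparison with `t` is asked
only where `w` wins, because `E w` kills the other terms. -/
theorem trace_lineProj_le (a : ℕ → unitInterval) (w : Player) (n : ℕ)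
    {R : Matrix (CheckMem n) (CheckMem n) ℂ} (hR : R.PosSemidef) {t : (Fin n → Fin 2) → ℝ}
    (ht : ∀ x, winner n x = w → (R (some x, some x) (some x, some x)).re ≤ t x) :
    (lineProj (checkVecMem a w n) * R).trace.re ≤
      (winProb a w n)⁻¹ * overlap a n (E w n) t ^ 2 := by
  have hW : 0 ≤ winProb a w n :=
    Finset.sum_nonneg fun x _ => mul_nonneg (E_nonneg w n x) (stringProb_nonneg a n x)
  have hstar := star_checkVecMem a w n
  rw [trace_lineProj_mul, checkVecMem_dotProduct_self, ← Complex.ofReal_inv,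
    Complex.re_ofReal_mul]
  refine mul_le_mul_of_nonneg_left ?_ (inv_nonneg.2 hW)
  have hstar' (q : CheckMem n) : star (checkVecMem a w n q) = checkVecMem a w n q :=
    congrFun hstar q
  simp only [hstar']
  simp only [sum_checkVecMem_mul]
  refine (Complex.re_le_norm _).trans ?_
  have hle (x : Fin n → Fin 2) : E w n x * √(R (some x, some x) (some x, some x)).re ≤
      E w n x * √(t x) := by
    by_cases h : winner n x = w
    · exact mul_le_mul_of_nonneg_left (Real.sqrt_le_sqrt (ht x h)) (E_nonneg w n x)
    · simp [E, h]
  calc _ ≤ ∑ x, ∑ y, (E w n x * √(stringProb a n x)) * (E w n y * √(stringProb a n y)) *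
        (√(R (some y, some y) (some y, some y)).re *
          √(R (some x, some x) (some x, some x)).re) := by
        refine (norm_sum_le _ _).trans (Finset.sum_le_sum fun x _ => ?_)
        rw [norm_mul, Complex.norm_real, Real.norm_of_nonneg
          (mul_nonneg (E_nonneg w n x) (Real.sqrt_nonneg _))]
        simp only [mul_assoc, ← Finset.mul_sum]
        refine mul_le_mul_of_nonneg_left (mul_le_mul_of_nonneg_left ?_ (Real.sqrt_nonneg _))
          (E_nonneg w n x)
        refine (norm_sum_le _ _).trans (Finset.sum_le_sum fun y _ => ?_)
        rw [norm_mul, Complex.norm_real, Real.norm_of_nonneg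
          (mul_nonneg (E_nonneg w n y) (Real.sqrt_nonneg _)), mul_assoc]
        exact mul_le_mul_of_nonneg_left (mul_le_mul_of_nonneg_left
          (norm_apply_le_of_posSemidef hR _ _) (Real.sqrt_nonneg _)) (E_nonneg w n y)
    _ = (∑ x, √(stringProb a n x) * (E w n x * √(R (some x, some x) (some x, some x)).re)) ^ 2 := by
        rw [sq, Finset.sum_mul_sum]
        refine Finset.sum_congr rfl fun x _ => Finset.sum_congr rfl fun y _ => ?_
        ring
    _ ≤ (∑ x, √(stringProb a n x) * (E w n x * √(t x))) ^ 2 := by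
        have h0 (x : Fin n → Fin 2) : 0 ≤ √(stringProb a n x) *
            (E w n x * √(R (some x, some x) (some x, some x)).re) :=
          mul_nonneg (Real.sqrt_nonneg _) (mul_nonneg (E_nonneg w n x) (Real.sqrt_nonneg _))
        refine pow_le_pow_left₀ (Finset.sum_nonneg fun x _ => h0 x)
          (Finset.sum_le_sum fun x _ => ?_) 2
        exact mul_le_mul_of_nonneg_left (hle x) (Real.sqrt_nonneg _)
    _ = _ := by
        rw [overlap]
        congr 1
        refine Finset.sum_congr rfl fun x _ => ?_
        ring

/-! ### The last two messages against a cheater -/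

section Finish

variable {α β γ m ω : Type} [Fintype α] [DecidableEq α] [Fintype β] [DecidableEq β] [Fintype γ]
  [DecidableEq γ] [Fintype m] [Fintype ω] [DecidableEq ω]

theorem Channel.measureMap_onRight_apply_eq_zero {o : α → ω} {f : α → β}
    (hf : ∀ x x', o x = o x' → f x = f x' → x = x') (ρ : Matrix (γ × α) (γ × α) ℂ) {p q : γ × β}
    (hp : ∀ x, f x ≠ p.2) : (Channel.measureMap o f hf).onRight ρ p q = 0 := by
  rw [Channel.onRight_apply]
  refine Finset.sum_eq_zero fun k _ => Finset.sum_eq_zero fun i _ =>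
    Finset.sum_eq_zero fun j _ => ?_
  have : (Channel.measureMap o f hf).kraus k p.2 i = 0 := if_neg fun h => hp i h.2.symm
  rw [this, zero_mul, zero_mul]

theorem Channel.ofInjective_id_onRight (ρ : Matrix (γ × α) (γ × α) ℂ) :
    (Channel.ofInjective id Function.injective_id).onRight ρ = ρ := by
  ext ⟨g, x⟩ ⟨g', x'⟩
  exact Channel.ofInjective_onRight_apply Function.injective_id ρ g g' x x'

theorem withPure_posSemidef {ρ : Matrix (α × β) (α × β) ℂ} (h : ρ.PosSemidef) (U : γ → ℂ) :
    (withPure ρ U).PosSemidef := by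
  have := (h.submatrix fun p : α × (β × γ) => (p.1, p.2.1)).mul_mul_conjTranspose_same
      (Matrix.diagonal fun p : α × (β × γ) => U p.2.2)
  convert this using 1
  ext p q
  simp only [withPure, Matrix.of_apply, Matrix.diagonal_conjTranspose, Matrix.mul_diagonal,
    Matrix.diagonal_mul, Matrix.submatrix_apply, Pi.star_apply]
  ring

/-- The content of the cheater's message is arbitrary; its joint probability with `x` is at most the
marginal of `x`. -/
theorem diagRight_passRight_le {ρ : Matrix ((α × m) × β) ((α × m) × β) ℂ} (h : ρ.PosSemidef)
    (x : β) (c : m) : diagRight (passRight ρ) (x, c) ≤ diagRight ρ x := by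
  have h0 (p : (α × m) × β) : 0 ≤ (ρ p p).re := (Complex.le_def.1 (h.diag_nonneg (i := p))).1
  simp only [diagRight, traceLeft_apply, Complex.re_sum, passRight, Matrix.submatrix_apply,
    Fintype.sum_prod_type]
  refine Finset.sum_le_sum fun i _ => ?_
  exact Finset.single_le_sum (f := fun c => (ρ ((i, c), x) ((i, c), x)).re)
    (fun c _ => h0 _) (Finset.mem_univ c)

theorem passRight_posSemidef {ρ : Matrix ((α × m) × β) ((α × m) × β) ℂ} (h : ρ.PosSemidef) :
    (passRight ρ).PosSemidef := h.submatrix _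

theorem passLeft_posSemidef {ρ : Matrix (α × (β × m)) (α × (β × m)) ℂ} (h : ρ.PosSemidef) :
    (passLeft ρ).PosSemidef := h.submatrix _

/-- If a measured and relabelled register is split into a kept part and a message, and the kept part
`y` comes from a single label `x`, then its probability is that of `x`. -/
theorem diagRight_passLeft_measureMap [DecidableEq m] {o : α → ω} {f : α → β × m}
    (hf : ∀ x x', o x = o x' → f x = f x' → x = x') (hf' : f.Injective)
    (ρ : Matrix (γ × α) (γ × α) ℂ) {x : α} (hx : ∀ x', (f x').1 = (f x).1 → x' = x) :
    diagRight (passLeft ((Channel.measureMap o f hf).onRight ρ)) (f x).1 = diagRight ρ x := by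
  simp only [diagRight, traceLeft_apply, Complex.re_sum, passLeft, Matrix.submatrix_apply,
    Fintype.sum_prod_type]
  refine Finset.sum_congr rfl fun i _ => ?_
  rw [Finset.sum_eq_single (f x).2]
  · rw [Prod.mk.eta, Channel.measureMap_onRight_apply hf hf', if_pos rfl]
  · intro c _ hc
    rw [Channel.measureMap_onRight_apply_eq_zero, Complex.zero_re]
    intro x' hx'
    change f x' = ((f x).1, c) at hx'
    have h1 := hx x' (by rw [hx'])
    subst h1
    exact hc (by rw [hx'])
  · simp

end Finish

theorem diagRight_withPure_unsentState {α : Type} [Fintype α] (a : ℕ → unitInterval) {n : ℕ}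
    (mine : Bool) (ρ : Matrix (α × (Fin n → Fin 2)) (α × (Fin n → Fin 2)) ℂ) (x : Fin n → Fin 2)
    (u : Unit) : diagRight (withPure ρ (unsentState a 0 mine n)) (x, u) = diagRight ρ x := by
  simp [diagRight, traceLeft_apply, withPure, unsentState]

/-- The label of Alice's kept register and of her message after her measurement. -/
def aliceSplit (n : ℕ) (p : (Fin n → Fin 2) × Unit) : CheckMem n :=
  if winner n p.1 = .alice then (none, some p.1) else (some p.1, none)

/-- The label of Bob's kept register and of his message after his measurement. -/
def bobSplit (n : ℕ) (p : ((Fin n → Fin 2) × Unit) × Option (Fin n → Fin 2)) :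
    CheckMem n × Option (Fin n → Fin 2) :=
  if winner n p.1.1 = .bob then ((none, p.2), some p.1.1) else ((some p.1.1, p.2), none)

theorem aliceSplit_injective (n : ℕ) : (aliceSplit n).Injective := by
  rintro ⟨x, u⟩ ⟨y, v⟩ h
  unfold aliceSplit at h
  split_ifs at h <;> simp_all

theorem bobSplit_injective (n : ℕ) : (bobSplit n).Injective := by
  rintro ⟨⟨x, u⟩, m⟩ ⟨⟨y, v⟩, m'⟩ h
  unfold bobSplit at h
  split_ifs at h <;> simp_all

/-- After Alice's measurement her kept register is out of Bob's reach, and the kept label `some x`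
can only come from the string `x`. Its probability is thus that of `x` before the detection; Bob's
message can only lower it. -/
theorem duel_aliceFinish_le (a : ℕ → unitInterval) {n : ℕ} (mine : Bool) (α : Register)
    (s : Strategy .bob (messagesFrom .alice .bob n 0) α)
    (ρ : Matrix (α × (Fin n → Fin 2)) (α × (Fin n → Fin 2)) ℂ) (hρ : ρ.PosSemidef) :
    duel alice_ne_bob.symm _ s (aliceFinish a n mine) (withPure ρ (unsentState a 0 mine n)) .bob ≤
      (winProb a .bob n)⁻¹ * overlap a n (E .bob n) (diagRight ρ) ^ 2 := by
  have hσ := withPure_posSemidef hρ (unsentState a 0 mine n)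
  have ht := diagRight_withPure_unsentState a mine ρ
  -- From here on only positivity and the diagonal of the state matter.
  generalize withPure ρ (unsentState a 0 mine n) = σ at hσ ht
  change Matrix (α × ((Fin n → Fin 2) × Unit)) (α × ((Fin n → Fin 2) × Unit)) ℂ at σ
  cases s with
  | send hs => exact absurd hs alice_ne_bob
  | recv hs C A =>
    cases A with
    | recv hs => exact absurd rfl hs
    | send hs C' A =>
      cases A with
      | measure M =>
        have hf (x y : (Fin n → Fin 2) × Unit) (_ : winner n x.1 = winner n y.1)
          (h : aliceSplit n x = aliceSplit n y) : x = y := aliceSplit_injective n h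
        -- The relabelling inside `aliceFinish` is `aliceSplit` by definition, and the proof stored
        -- in the channel is irrelevant.
        change (lineProj (checkVecMem a .bob n) * traceLeft ((Channel.ofInjective
          (id : CheckMem n → CheckMem n) Function.injective_id).onRight (passRight (C'.onLeft
            (C.onLeft (passLeft ((Channel.measureMap (fun p => winner n p.1)
              (aliceSplit n) hf).onRight σ))))))).trace.re ≤ _
        rw [Channel.ofInjective_id_onRight]
        have hω := C'.onLeft_posSemidef (C.onLeft_posSemidef (passLeft_posSemidef
          ((Channel.measureMap (fun p => winner n p.1) (aliceSplit n) hf).onRight_posSemidef hσ)))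
        refine trace_lineProj_le a .bob n (traceLeft_posSemidef (passRight_posSemidef hω))
          fun x hx => (diagRight_passRight_le hω _ _).trans (le_of_eq ?_)
        simp only [diagRight, traceLeft_onLeft]
        have hsplit : aliceSplit n (x, ()) = (some x, none) := by simp [aliceSplit, hx]
        have := diagRight_passLeft_measureMap hf (aliceSplit_injective n) σ (x := (x, ()))
          (by
            rintro ⟨y, _⟩ h
            rw [hsplit] at h
            unfold aliceSplit at h
            split_ifs at h
            simp_all)
        rw [hsplit] at this
        exact this.trans (ht x ())

/-- Bob receives before he measures, so the loss from fixing Alice's message to `some x` occurs in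
the state that enters his measurement, and the measurement preserves the probability of the combined
label. -/
theorem duel_bobFinish_le (a : ℕ → unitInterval) {n : ℕ} (mine : Bool) (α : Register)
    (s : Strategy .alice (messagesFrom .alice .bob n 0) α)
    (ρ : Matrix (α × (Fin n → Fin 2)) (α × (Fin n → Fin 2)) ℂ) (hρ : ρ.PosSemidef) :
    duel alice_ne_bob _ s (bobFinish a n mine) (withPure ρ (unsentState a 0 mine n)) .alice ≤
      (winProb a .alice n)⁻¹ * overlap a n (E .alice n) (diagRight ρ) ^ 2 := by
  have hσ := withPure_posSemidef hρ (unsentState a 0 mine n)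
  have ht := diagRight_withPure_unsentState a mine ρ
  generalize withPure ρ (unsentState a 0 mine n) = σ at hσ ht
  change Matrix (α × ((Fin n → Fin 2) × Unit)) (α × ((Fin n → Fin 2) × Unit)) ℂ at σ
  cases s with
  | recv hs => exact absurd rfl hs
  | send hs C A =>
    cases A with
    | send hs => exact absurd hs alice_ne_bob.symm
    | recv hs C' A =>
      cases A with
      | measure M =>
        have hf (x y : ((Fin n → Fin 2) × Unit) × Option (Fin n → Fin 2))
          (_ : winner n x.1.1 = winner n y.1.1)
          (h : bobSplit n x = bobSplit n y) : x = y := bobSplit_injective n h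
        change (lineProj (checkVecMem a .alice n) * traceLeft (C'.onLeft (passLeft
          ((Channel.measureMap (fun p => winner n p.1.1) (bobSplit n) hf).onRight
            ((Channel.ofInjective (id : ((Fin n → Fin 2) × Unit) × Option (Fin n → Fin 2) → _)
              Function.injective_id).onRight (passRight (C.onLeft σ))))))).trace.re ≤ _
        rw [Channel.ofInjective_id_onRight, traceLeft_onLeft]
        have hω := C.onLeft_posSemidef hσ
        refine trace_lineProj_le a .alice n (traceLeft_posSemidef (passLeft_posSemidef
          (Channel.onRight_posSemidef _ (passRight_posSemidef hω)))) fun x hx => ?_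
        have hsplit : bobSplit n ((x, ()), some x) = ((some x, some x), none) := by
          simp [bobSplit, hx]
        have := diagRight_passLeft_measureMap hf (bobSplit_injective n) (passRight (C.onLeft σ))
          (x := ((x, ()), some x))
          (by
            rintro ⟨⟨y, _⟩, o⟩ h
            rw [hsplit] at h
            unfold bobSplit at h
            split_ifs at h <;> simp_all)
        rw [hsplit] at this
        refine this.le.trans ((diagRight_passRight_le hω _ _).trans (le_of_eq ?_))
        refine Eq.trans ?_ (ht x ())
        simp only [diagRight, traceLeft_onLeft]
        rfl

/-! ### The bounds on cheating -/

theorem traceLast_nonneg (a : unitInterval) {n : ℕ} {d : (Fin (n + 1) → Fin 2) → ℝ}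
    (hd : ∀ x, 0 ≤ d x) (x : Fin n → Fin 2) : 0 ≤ traceLast a d x :=
  add_nonneg (mul_nonneg a.2.1 (hd _)) (mul_nonneg (sub_nonneg.2 a.2.2) (hd _))

/-- `nested` retains only the end result of eliminating the qubits, while the induction along the
protocol needs every intermediate diagonal. -/
theorem exists_nested_family (a : ℕ → unitInterval) (h : Player) (n : ℕ)
    (d : (Fin n → Fin 2) → ℝ) (hd : ∀ x, 0 ≤ d x) :
    ∃ D : ∀ k, (Fin k → Fin 2) → ℝ, (∀ k x, 0 ≤ D k x) ∧ D n = d ∧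
      (∀ k < n, D k = if sender (k + 1) = h then traceLast (a (k + 1)) (D (k + 1))
        else rmsLast (a (k + 1)) (D (k + 1))) ∧
      nested a h n d = D 0 Fin.elim0 := by
  induction n with
  | zero =>
    -- Levels above the top one are never used; zero keeps them nonnegative.
    refine ⟨Function.update (fun _ _ => 0) 0 d, fun k x => ?_, by simp, by simp, by simp [nested]⟩
    by_cases hk : k = 0
    · subst hk
      simpa using hd x
    · simp [Function.update_of_ne hk]
  | succ n ih =>
    obtain ⟨D, hD0, hDn, hD, hDe⟩ := ih (if sender (n + 1) = h then traceLast (a (n + 1)) d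
      else rmsLast (a (n + 1)) d) (fun x => by
        split_ifs
        · exact traceLast_nonneg _ hd x
        · exact Real.sqrt_nonneg _)
    refine ⟨Function.update D (n + 1) d, fun k x => ?_, by simp, fun k hk => ?_, ?_⟩
    · by_cases hk : k = n + 1
      · subst hk
        simpa using hd x
      · rw [Function.update_of_ne hk]
        exact hD0 k x
    · rw [Function.update_of_ne hk.ne]
      rcases Nat.lt_succ_iff_lt_or_eq.1 hk with hk | rfl
      · rw [Function.update_of_ne (by omega), hD k hk]
      · rw [Function.update_self, hDn]
    · rw [Function.update_of_ne (by omega), nested, hDe]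

theorem winProb_nonneg (a : ℕ → unitInterval) (w : Player) (n : ℕ) : 0 ≤ winProb a w n :=
  Finset.sum_nonneg fun x _ => mul_nonneg (E_nonneg w n x) (stringProb_nonneg a n x)

/-- A bound for a cheater who faces an honest player, from a bound for the cheat detection. -/
theorem duel_le_nested {c h : Player} (hne : c ≠ h) (a : ℕ → unitInterval) {n : ℕ} {K : ℝ}
    (hK : 0 ≤ K)
    (finish : ∀ (k : ℕ) (mine : Bool), Strategy h (messagesFrom .alice .bob k 0) (stage k 0 mine))
    (hfin : ∀ (mine : Bool) (α : Register) (s : Strategy c (messagesFrom .alice .bob n 0) α)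
      (ρ : Matrix (α × (Fin n → Fin 2)) (α × (Fin n → Fin 2)) ℂ), ρ.PosSemidef →
      duel hne _ s (finish n mine) (withPure ρ (unsentState a 0 mine n)) c ≤
        K * overlap a n (E c n) (diagRight ρ) ^ 2)
    (mine : Bool) (hmine : sender 1 = h ↔ mine = true) {α : Register}
    (s : Strategy c (messagesFrom (cond mine h c) (cond mine c h) 0 n) α)
    {τ : Matrix α α ℂ} (hτ : τ.PosSemidef) (htr : τ.trace = 1)
    {ρ : Matrix (α × ((Fin 0 → Fin 2) × unsent n mine)) (α × ((Fin 0 → Fin 2) × unsent n mine)) ℂ}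
    (hρ : ∀ p q, ρ p q = τ p.1 q.1 *
      (unsentState a n mine 0 p.2.2 * star (unsentState a n mine 0 q.2.2))) :
    duel hne _ s (exchange hne finish n 0 mine) ρ c ≤ K * nested a h n (E c n) ^ 2 := by
  obtain ⟨D, hD0, hDn, hD, hDe⟩ := exists_nested_family a h n (E c n) (E_nonneg c n)
  have hw : ρ = withPure (τ.submatrix Prod.fst Prod.fst) (unsentState a n mine 0) := by
    ext p q
    exact hρ p q
  have key := duel_exchange_le hne a hK D hD0 hD finish (w := c) (by rwa [hDn]) n 0 mine
    (zero_add n) hmine α s (τ.submatrix Prod.fst Prod.fst) (hτ.submatrix _)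
  -- Before the first message there is one empty string. Its honest probability is an empty product
  -- and its actual one is the trace of the cheater's state, both equal to 1.
  have hov : overlap a 0 (D 0)
      (diagRight (τ.submatrix (Prod.fst : α × (Fin 0 → Fin 2) → α) Prod.fst)) =
      D 0 Fin.elim0 := by
    have h1 (x : Fin 0 → Fin 2) :
        diagRight (τ.submatrix (Prod.fst : α × (Fin 0 → Fin 2) → α) Prod.fst) x = 1 := by
      change (τ.trace).re = 1
      rw [htr, Complex.one_re]
    simp only [overlap, h1, Fintype.sum_unique, stringProb]
    simp
    congr 1
  rw [hov, ← hDe, ← hw] at key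
  exact key

theorem cheatAlice_le (n : ℕ) (a : ℕ → unitInterval) :
    (protocol n a).cheatAlice ≤ (winProb a .alice n)⁻¹ * nested a .bob n (E .alice n) ^ 2 := by
  have hK : 0 ≤ (winProb a .alice n)⁻¹ := inv_nonneg.2 (winProb_nonneg a .alice n)
  -- The nonnegative bound is demanded because `sSup ∅ = 0` on the reals.
  refine Real.sSup_le ?_ (by positivity)
  rintro _ ⟨A, rfl⟩
  refine (sum_run_alice _ _ _ _).trans_le ?_
  exact duel_le_nested alice_ne_bob a hK (bobFinish a)
    (fun mine α s ρ hρ => duel_bobFinish_le a mine α s ρ hρ) false (by decide) A.strategy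
    A.posSemidef A.trace_eq_one fun p q => rfl

theorem cheatBob_le (n : ℕ) (a : ℕ → unitInterval) :
    (protocol n a).cheatBob ≤ (winProb a .bob n)⁻¹ * nested a .alice n (E .bob n) ^ 2 := by
  have hK : 0 ≤ (winProb a .bob n)⁻¹ := inv_nonneg.2 (winProb_nonneg a .bob n)
  refine Real.sSup_le ?_ (by positivity)
  rintro _ ⟨B, rfl⟩
  refine (sum_run_bob _ _ _ _).trans_le ?_
  exact duel_le_nested alice_ne_bob.symm a hK (aliceFinish a)
    (fun mine α s ρ hρ => duel_aliceFinish_le a mine α s ρ hρ) true (by decide) B.strategy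
    B.posSemidef B.trace_eq_one fun p q => mul_comm _ _

theorem length_messagesFrom (p q : Player) (k j : ℕ) : (messagesFrom p q k j).length = j + 2 := by
  induction j generalizing p q k with
  | zero => rfl
  | succ j ih => simp [messagesFrom, ih]

/-! ### Fairness -/

section Pure

variable {α β γ m ω ι : Type} [Fintype α] [DecidableEq α] [Fintype β] [DecidableEq β] [Fintype γ]
  [DecidableEq γ] [Fintype ω] [DecidableEq ω]

/-- The density matrix of a pure state. -/
def pureState (Ψ : α → ℂ) : Matrix α α ℂ := Matrix.vecMulVec Ψ (star Ψ)

/-- There is one Kraus operator per outcome, so a pure state becomes a sum of unnormalized pure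
states indexed by the outcomes. -/
theorem Channel.measureMap_onLeft_pureState {o : α → ω} {f : α → β}
    (hf : ∀ x x', o x = o x' → f x = f x' → x = x') (Ψ : α × γ → ℂ) :
    (Channel.measureMap o f hf).onLeft (pureState Ψ) =
      ∑ w, pureState fun p => ∑ x, if o x = w ∧ p.1 = f x then Ψ (x, p.2) else 0 := by
  ext p q
  rw [Channel.onLeft_apply, Matrix.sum_apply]
  refine Finset.sum_congr rfl fun w _ => ?_
  simp only [pureState, Matrix.vecMulVec_apply, Pi.star_apply, star_sum, Finset.sum_mul_sum]
  refine Finset.sum_congr rfl fun i _ => Finset.sum_congr rfl fun j _ => ?_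
  simp only [Channel.measureMap, Matrix.of_apply]
  split_ifs <;> simp

theorem Channel.measureMap_onRight_pureState {o : α → ω} {f : α → β}
    (hf : ∀ x x', o x = o x' → f x = f x' → x = x') (Ψ : γ × α → ℂ) :
    (Channel.measureMap o f hf).onRight (pureState Ψ) =
      ∑ w, pureState fun p => ∑ x, if o x = w ∧ p.2 = f x then Ψ (p.1, x) else 0 := by
  ext p q
  rw [Channel.onRight_apply, Matrix.sum_apply]
  refine Finset.sum_congr rfl fun w _ => ?_
  simp only [pureState, Matrix.vecMulVec_apply, Pi.star_apply, star_sum, Finset.sum_mul_sum]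
  refine Finset.sum_congr rfl fun i _ => Finset.sum_congr rfl fun j _ => ?_
  simp only [Channel.measureMap, Matrix.of_apply]
  split_ifs <;> simp

theorem Channel.onRight_sum (C : Channel α β) (s : Finset ι)
    (ρ : ι → Matrix (γ × α) (γ × α) ℂ) : C.onRight (∑ i ∈ s, ρ i) = ∑ i ∈ s, C.onRight (ρ i) := by
  simp only [Channel.onRight, Matrix.mul_sum, Matrix.sum_mul]
  exact Finset.sum_comm

theorem passRight_sum (s : Finset ι) (ρ : ι → Matrix ((α × m) × β) ((α × m) × β) ℂ) :
    passRight (∑ i ∈ s, ρ i) = ∑ i ∈ s, passRight (ρ i) := by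
  ext p q
  simp [passRight, Matrix.sum_apply]

theorem passLeft_sum (s : Finset ι) (ρ : ι → Matrix (α × (β × m)) (α × (β × m)) ℂ) :
    passLeft (∑ i ∈ s, ρ i) = ∑ i ∈ s, passLeft (ρ i) := by
  ext p q
  simp [passLeft, Matrix.sum_apply]

/-- The expectation of an observable in a pure state. -/
def expect (M : Matrix α α ℂ) (v : α → ℂ) : ℂ := star v ⬝ᵥ M *ᵥ v

theorem trace_kronecker_mul_pureState (M : Matrix α α ℂ) (N : Matrix γ γ ℂ) (f : α → ℂ)
    (g : γ → ℂ) :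
    ((M ⊗ₖ N) * pureState fun p : α × γ => f p.1 * g p.2).trace = expect M f * expect N g := by
  have h (p : α × γ) : ((M ⊗ₖ N) *ᵥ fun p : α × γ => f p.1 * g p.2) p =
      (M *ᵥ f) p.1 * (N *ᵥ g) p.2 := by
    simp only [Matrix.mulVec, dotProduct, Matrix.kroneckerMap_apply, Fintype.sum_prod_type,
      Finset.sum_mul_sum]
    refine Finset.sum_congr rfl fun i _ => Finset.sum_congr rfl fun j _ => ?_
    ring
  rw [pureState, Matrix.mul_vecMulVec, Matrix.trace_vecMulVec, expect, expect]
  simp only [dotProduct, h, Pi.star_apply, Fintype.sum_prod_type, Finset.sum_mul_sum, star_mul']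
  refine Finset.sum_congr rfl fun i _ => Finset.sum_congr rfl fun j _ => ?_
  ring

theorem expect_one_sub (M : Matrix α α ℂ) (v : α → ℂ) :
    expect (1 - M) v = star v ⬝ᵥ v - expect M v := by
  simp [expect, Matrix.sub_mulVec]

theorem expect_lineProj (v w : α → ℂ) :
    expect (lineProj v) w = (v ⬝ᵥ star v)⁻¹ * ((star v ⬝ᵥ w) * (star w ⬝ᵥ v)) := by
  simp [expect, lineProj, Matrix.smul_mulVec, Matrix.vecMulVec_mulVec]

end Pure

/-- The check vector is fixed by the projection onto its own line, so the expectation is its squared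
norm; if this norm vanishes, everything is zero. -/
theorem expect_finalMeasurement_checkVecMem (a : ℕ → unitInterval) (w w' : Player) (n : ℕ) :
    expect ((finalMeasurement a w n).proj w') (checkVecMem a w n) =
      if w' = w then (winProb a w n : ℂ) else 0 := by
  have h := checkVecMem_dotProduct_self a w n
  have h' : star (checkVecMem a w n) ⬝ᵥ checkVecMem a w n = (winProb a w n : ℂ) := by
    rw [dotProduct_comm, h]
  have e : expect (lineProj (checkVecMem a w n)) (checkVecMem a w n) = (winProb a w n : ℂ) := by
    rw [expect_lineProj, h, h']
    by_cases h0 : (winProb a w n : ℂ) = 0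
    · simp [h0]
    · rw [inv_mul_cancel_left₀ h0]
  simp only [finalMeasurement]
  split_ifs
  · exact e
  · rw [expect_one_sub, e, h', sub_self]

theorem expect_finalMeasurement_none (a : ℕ → unitInterval) (w w' : Player) (n : ℕ) :
    expect ((finalMeasurement a w n).proj w') (Pi.single ((none, none) : CheckMem n) (1 : ℂ)) =
      if w' = w then 0 else 1 := by
  have h : star (checkVecMem a w n) ⬝ᵥ Pi.single ((none, none) : CheckMem n) (1 : ℂ) = 0 := by
    rw [star_checkVecMem, dotProduct_single]
    exact zero_mul _
  have e : expect (lineProj (checkVecMem a w n))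
      (Pi.single ((none, none) : CheckMem n) (1 : ℂ)) = 0 := by
    rw [expect_lineProj, h, zero_mul, mul_zero]
  simp only [finalMeasurement]
  split_ifs
  · exact e
  · rw [expect_one_sub, e]
    simp

theorem Channel.ofInjective_id_onLeft {α γ : Type} [Fintype α] [DecidableEq α] [Fintype γ]
    [DecidableEq γ] (ρ : Matrix (α × γ) (α × γ) ℂ) :
    (Channel.ofInjective id Function.injective_id).onLeft ρ = ρ := by
  have := Channel.ofInjective_id_onRight (swapState ρ)
  rw [Channel.onRight_swapState] at this
  exact congrArg swapState this

theorem sum_eq_checkVecMem (a : ℕ → unitInterval) (n : ℕ) (w : Player)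
    (o m : Option (Fin n → Fin 2)) :
    (∑ y, if o = some y ∧ m = some y then ((E w n y * √(stringProb a n y) : ℝ) : ℂ) else 0) =
      checkVecMem a w n ((o, m) : CheckMem n) := by
  rcases o with _ | x
  · simp [checkVecMem]
  rcases m with _ | y
  · simp [checkVecMem]
  rw [checkVecMem_some, Finset.sum_eq_single x]
  · simp [eq_comm]
  · intro z _ hz
    simp [hz.symm]
  · simp

/-- The branch of the joint state in which Alice obtains `w` and Bob obtains `w'`. -/
theorem check_branch (a : ℕ → unitInterval) (n : ℕ) (w w' : Player) (p q : CheckMem n) :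
    (∑ z : ((Fin n → Fin 2) × Unit) × Option (Fin n → Fin 2),
      if winner n z.1.1 = w' ∧ (q, p.2) = bobSplit n z then
        ∑ x : (Fin n → Fin 2) × Unit, if winner n x.1 = w ∧ (p.1, z.2) = aliceSplit n x then
          psi a n (x.1, z.1.1) else 0 else 0) =
      if w = w' then if w = .alice then
          Pi.single (M := fun _ => ℂ) ((none, none) : CheckMem n) 1 p * checkVecMem a .alice n q
        else checkVecMem a .bob n p * Pi.single (M := fun _ => ℂ) ((none, none) : CheckMem n) 1 q
      else 0 := by
  obtain ⟨o, m⟩ := p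
  obtain ⟨o', m'⟩ := q
  -- `ψ` is diagonal, so Bob's string `y` determines Alice's.
  have h1 (y : Fin n → Fin 2) (c : Option (Fin n → Fin 2)) :
      (∑ x : (Fin n → Fin 2) × Unit, if winner n x.1 = w ∧ (o, c) = aliceSplit n x then
        psi a n (x.1, y) else 0) =
      if winner n y = w ∧ (o, c) = aliceSplit n (y, ()) then ((√(stringProb a n y) : ℝ) : ℂ)
        else 0 := by
    rw [Fintype.sum_prod_type, Finset.sum_eq_single y]
    · rw [Fintype.sum_unique, psi_apply, if_pos rfl]
    · intro x _ hx
      rw [Fintype.sum_unique, psi_apply, if_neg hx, ite_self]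
    · simp
  have h2 (y : Fin n → Fin 2) (v : Player) :
      (if winner n y = v then ((√(stringProb a n y) : ℝ) : ℂ) else 0) =
        ((E v n y * √(stringProb a n y) : ℝ) : ℂ) := by
    unfold E
    split_ifs <;> simp
  rw [Fintype.sum_prod_type, Fintype.sum_prod_type]
  simp only [h1, Fintype.sum_unique]
  cases w <;> cases w'
  -- Bob stores Alice's message `c` as `m'`. When she wins she sends her whole string and keeps
  -- nothing, and Bob sends nothing; the other surviving case has the roles exchanged.
  · have h3 (y : Fin n → Fin 2) (c : Option (Fin n → Fin 2)) :
        (if winner n y = .alice ∧ ((o', m'), m) = bobSplit n ((y, default), c) then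
          if winner n y = .alice ∧ (o, c) = aliceSplit n (y, ()) then
            ((√(stringProb a n y) : ℝ) : ℂ) else 0 else 0) =
        if c = m' then if o' = some y ∧ m' = some y ∧ o = none ∧ m = none then
          ((E .alice n y * √(stringProb a n y) : ℝ) : ℂ) else 0 else 0 := by
      rw [← h2]
      unfold aliceSplit bobSplit
      by_cases hy : winner n y = .alice <;> simp only [hy] <;> grind
    simp only [h3, Finset.sum_ite_eq', Finset.mem_univ, if_true]
    rw [← sum_eq_checkVecMem]
    rcases o with _ | x <;> rcases m with _ | x' <;> simp
  · simp +contextual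
  · simp +contextual
  · have h3 (y : Fin n → Fin 2) (c : Option (Fin n → Fin 2)) :
        (if winner n y = .bob ∧ ((o', m'), m) = bobSplit n ((y, default), c) then
          if winner n y = .bob ∧ (o, c) = aliceSplit n (y, ()) then
            ((√(stringProb a n y) : ℝ) : ℂ) else 0 else 0) =
        if c = m' then if o = some y ∧ m = some y ∧ o' = none ∧ m' = none then
          ((E .bob n y * √(stringProb a n y) : ℝ) : ℂ) else 0 else 0 := by
      rw [← h2]
      unfold aliceSplit bobSplit
      by_cases hy : winner n y = .bob <;> simp only [hy] <;> grind
    simp only [h3, Finset.sum_ite_eq', Finset.mem_univ, if_true]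
    rw [← sum_eq_checkVecMem a n .bob]
    rcases o' with _ | x <;> rcases m' with _ | x' <;> simp

/-- Branches with different outcomes for the two players vanish. In each of the others the
amplitudes are a product of a check vector and the empty label `(none, none)`, so the final trace
factorizes into two expectations. -/
theorem run_finish (a : ℕ → unitInterval) (n : ℕ) (mine mine' : Bool) (x y : Player) :
    run _ (aliceFinish a n mine) (bobFinish a n mine')
      (pureState fun p : ((Fin n → Fin 2) × Unit) × ((Fin n → Fin 2) × Unit) =>
        psi a n (p.1.1, p.2.1)) x y = if x = y then winProb a x n else 0 := by
  have hf (x y : (Fin n → Fin 2) × Unit) (_ : winner n x.1 = winner n y.1)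
    (h : aliceSplit n x = aliceSplit n y) : x = y := aliceSplit_injective n h
  have hg (x y : ((Fin n → Fin 2) × Unit) × Option (Fin n → Fin 2))
    (_ : winner n x.1.1 = winner n y.1.1)
    (h : bobSplit n x = bobSplit n y) : x = y := bobSplit_injective n h
  change ((((finalMeasurement a .bob n).proj x ⊗ₖ (finalMeasurement a .alice n).proj y) *
    ((Channel.ofInjective (id : CheckMem n → CheckMem n) Function.injective_id).onLeft (passLeft
      ((Channel.measureMap (fun p => winner n p.1.1) (bobSplit n) hg).onRight
        ((Channel.ofInjective (id : ((Fin n → Fin 2) × Unit) × Option (Fin n → Fin 2) → _)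
          Function.injective_id).onRight (passRight
            ((Channel.measureMap (fun p => winner n p.1) (aliceSplit n) hf).onLeft
              (pureState fun p : ((Fin n → Fin 2) × Unit) × ((Fin n → Fin 2) × Unit) =>
                psi a n (p.1.1, p.2.1))))))))).trace).re = _
  rw [Channel.ofInjective_id_onLeft, Channel.ofInjective_id_onRight,
    Channel.measureMap_onLeft_pureState, passRight_sum, Channel.onRight_sum, passLeft_sum]
  have hbranch (w : Player) : passLeft ((Channel.measureMap (fun p => winner n p.1.1)
      (bobSplit n) hg).onRight (passRight (pureState
        fun p : CheckMem n × ((Fin n → Fin 2) × Unit) =>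
          ∑ x : (Fin n → Fin 2) × Unit, if winner n x.1 = w ∧ p.1 = aliceSplit n x then
            psi a n (x.1, p.2.1) else 0))) =
      ∑ w', pureState fun p : CheckMem n × CheckMem n => if w = w' then if w = .alice then
          Pi.single (M := fun _ => ℂ) ((none, none) : CheckMem n) 1 p.1 *
            checkVecMem a .alice n p.2
        else checkVecMem a .bob n p.1 *
          Pi.single (M := fun _ => ℂ) ((none, none) : CheckMem n) 1 p.2
      else 0 := by
    simp only [← check_branch]
    refine (congrArg passLeft (Channel.measureMap_onRight_pureState hg
      fun q : Option (Fin n → Fin 2) × (((Fin n → Fin 2) × Unit) × Option (Fin n → Fin 2)) =>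
        ∑ x : (Fin n → Fin 2) × Unit, if winner n x.1 = w ∧ (q.1, q.2.2) = aliceSplit n x then
            psi a n (x.1, q.2.1.1) else 0)).trans ?_
    rw [passLeft_sum]
    rfl
  refine (congrArg (fun τ => (((finalMeasurement a .bob n).proj x ⊗ₖ
    (finalMeasurement a .alice n).proj y) * τ).trace.re)
    (Finset.sum_congr rfl fun w _ => hbranch w)).trans ?_
  have huniv : (Finset.univ : Finset Player) = {.alice, .bob} := rfl
  have hzero : pureState (fun _ : CheckMem n × CheckMem n => (0 : ℂ)) = 0 := by
    ext p q
    simp [pureState, Matrix.vecMulVec_apply]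
  simp only [huniv, Finset.sum_pair alice_ne_bob, alice_ne_bob, alice_ne_bob.symm, if_true,
    if_false, hzero, add_zero, zero_add]
  rw [mul_add, Matrix.trace_add, trace_kronecker_mul_pureState, trace_kronecker_mul_pureState,
    expect_finalMeasurement_checkVecMem, expect_finalMeasurement_checkVecMem,
    expect_finalMeasurement_none, expect_finalMeasurement_none]
  cases x <;> cases y <;> simp

theorem Channel.ofInjective_onLeft_apply {α β γ : Type} [Fintype α] [DecidableEq α] [Fintype β]
    [DecidableEq β] [Fintype γ] [DecidableEq γ] {f : α → β} (hf : f.Injective)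
    (ρ : Matrix (α × γ) (α × γ) ℂ) (g g' : γ) (x x' : α) :
    (Channel.ofInjective f hf).onLeft ρ (f x, g) (f x', g') = ρ (x, g) (x', g') := by
  rw [Channel.ofInjective, Channel.measureMap_onLeft_apply _ hf, if_pos rfl]

/-! ### Amplitudes during the honest exchange -/

section HonestExchange

variable {β γ : Type} [Fintype β] [DecidableEq β] [Fintype γ] [DecidableEq γ] {k : ℕ}

/-- Sending and receiving are both injective relabellings, so their combined effect on the
amplitudes is substitution: the two bits of the pair become the last bits of the two strings. -/
theorem left_sends_qubit
    {f : (Fin k → Fin 2) × ((Fin 2 × Fin 2) × β) → ((Fin (k + 1) → Fin 2) × β) × Fin 2}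
    (hf : f.Injective) (hf' : ∀ p, f p = ((Fin.snoc p.1 p.2.1.1, p.2.2), p.2.1.2))
    {g : ((Fin k → Fin 2) × γ) × Fin 2 → (Fin (k + 1) → Fin 2) × γ}
    (hg : g.Injective) (hg' : ∀ p, g p = (Fin.snoc p.1.1 p.2, p.1.2))
    (Φ : ((Fin k → Fin 2) × ((Fin 2 × Fin 2) × β)) × ((Fin k → Fin 2) × γ) → ℂ) :
    (Channel.ofInjective g hg).onRight (passRight
      ((Channel.ofInjective f hf).onLeft (pureState Φ))) =
      pureState fun p : ((Fin (k + 1) → Fin 2) × β) × ((Fin (k + 1) → Fin 2) × γ) =>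
        Φ ((Fin.init p.1.1, (p.1.1 (Fin.last k), p.2.1 (Fin.last k)), p.1.2),
          (Fin.init p.2.1, p.2.2)) := by
  ext ⟨⟨x, u⟩, y, w⟩ ⟨⟨x', u'⟩, y', w'⟩
  have hF (x : Fin (k + 1) → Fin 2) (u : β) (c : Fin 2) :
      ((x, u), c) = f (Fin.init x, (x (Fin.last k), c), u) := by
    simp [hf']
  have hG (x : Fin (k + 1) → Fin 2) (u : γ) : (x, u) = g ((Fin.init x, u), x (Fin.last k)) := by
    simp [hg']
  rw [hG y w, hG y' w', Channel.ofInjective_onRight_apply, ← hG, ← hG]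
  change (Channel.ofInjective f hf).onLeft (pureState Φ) (((x, u), y (Fin.last k)), (Fin.init y, w))
    (((x', u'), y' (Fin.last k)), (Fin.init y', w')) = _
  rw [hF x u, hF x' u', Channel.ofInjective_onLeft_apply]
  rfl

theorem right_sends_qubit
    {f : (Fin k → Fin 2) × ((Fin 2 × Fin 2) × β) → ((Fin (k + 1) → Fin 2) × β) × Fin 2}
    (hf : f.Injective) (hf' : ∀ p, f p = ((Fin.snoc p.1 p.2.1.1, p.2.2), p.2.1.2))
    {g : ((Fin k → Fin 2) × γ) × Fin 2 → (Fin (k + 1) → Fin 2) × γ}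
    (hg : g.Injective) (hg' : ∀ p, g p = (Fin.snoc p.1.1 p.2, p.1.2))
    (Φ : ((Fin k → Fin 2) × γ) × ((Fin k → Fin 2) × ((Fin 2 × Fin 2) × β)) → ℂ) :
    (Channel.ofInjective g hg).onLeft (passLeft
      ((Channel.ofInjective f hf).onRight (pureState Φ))) =
      pureState fun p : ((Fin (k + 1) → Fin 2) × γ) × ((Fin (k + 1) → Fin 2) × β) =>
        Φ ((Fin.init p.1.1, p.1.2),
          (Fin.init p.2.1, (p.2.1 (Fin.last k), p.1.1 (Fin.last k)), p.2.2)) := by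
  ext ⟨⟨y, w⟩, x, u⟩ ⟨⟨y', w'⟩, x', u'⟩
  have hF (x : Fin (k + 1) → Fin 2) (u : β) (c : Fin 2) :
      ((x, u), c) = f (Fin.init x, (x (Fin.last k), c), u) := by
    simp [hf']
  have hG (x : Fin (k + 1) → Fin 2) (u : γ) : (x, u) = g ((Fin.init x, u), x (Fin.last k)) := by
    simp [hg']
  rw [hG y w, hG y' w', Channel.ofInjective_onLeft_apply, ← hG, ← hG]
  change (Channel.ofInjective f hf).onRight (pureState Φ)
    ((Fin.init y, w), ((x, u), y (Fin.last k))) ((Fin.init y', w'), ((x', u'), y' (Fin.last k))) = _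
  rw [hF x u, hF x' u', Channel.ofInjective_onRight_apply]
  rfl

end HonestExchange

theorem run_send_recv {s : Player} {m : Register} {l : List Message}
    {α α' β β' : Register} (hs : s = .alice) (C : Channel α (α' × m)) (A : Strategy .alice l α')
    (hs' : s ≠ .bob) (D : Channel (β × m) β') (B : Strategy .bob l β')
    (ρ : Matrix (α × β) (α × β) ℂ) (x y : Player) :
    run (⟨s, m⟩ :: l) (.send hs C A) (.recv hs' D B) ρ x y =
      run l A B (D.onRight (passRight (C.onLeft ρ))) x y := by
  simp only [run]

theorem run_recv_send {s : Player} {m : Register} {l : List Message}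
    {α α' β β' : Register} (hs : s ≠ .alice) (C : Channel (α × m) α') (A : Strategy .alice l α')
    (hs' : s = .bob) (D : Channel β (β' × m)) (B : Strategy .bob l β')
    (ρ : Matrix (α × β) (α × β) ℂ) (x y : Player) :
    run (⟨s, m⟩ :: l) (.recv hs C A) (.send hs' D B) ρ x y =
      run l A B (C.onLeft (passLeft (D.onRight ρ))) x y := by
  simp only [run]

theorem psi_succ (a : ℕ → unitInterval) (k : ℕ) (x y : Fin (k + 1) → Fin 2) :
    psi a (k + 1) (x, y) =
      psi a k (Fin.init x, Fin.init y) * phi (a (k + 1)) (x (Fin.last k), y (Fin.last k)) := by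
  simp [psi, Fin.prod_univ_castSucc, Fin.init]

theorem phi_comm (a : unitInterval) (b c : Fin 2) : phi a (b, c) = phi a (c, b) := by
  rw [phi_apply, phi_apply]
  by_cases h : b = c
  · rw [h]
  · rw [if_neg h, if_neg (Ne.symm h)]

/-- The amplitudes of the joint state of two honest players during the exchange. -/
def honestState (a : ℕ → unitInterval) (j k : ℕ) (b b' : Bool)
    (p : ((Fin k → Fin 2) × unsent j b) × ((Fin k → Fin 2) × unsent j b')) : ℂ :=
  psi a k (p.1.1, p.2.1) * (unsentState a j b k p.1.2 * unsentState a j b' k p.2.2)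

/-- Both patterns of flags are treated together because each message turns one into the other. -/
theorem run_exchange (a : ℕ → unitInterval) (n : ℕ) (x y : Player) (j k : ℕ) (hkn : k + j = n) :
    (run _ (exchange alice_ne_bob.symm (aliceFinish a) j k true)
      (exchange alice_ne_bob (bobFinish a) j k false) (pureState (honestState a j k true false)) x y
        = if x = y then winProb a x n else 0) ∧
    (run _ (exchange alice_ne_bob.symm (aliceFinish a) j k false)
      (exchange alice_ne_bob (bobFinish a) j k true) (pureState (honestState a j k false true)) x y
        = if x = y then winProb a x n else 0) := by
  induction j generalizing k with
  | zero =>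
    obtain rfl : k = n := hkn
    have h (b b' : Bool) : pureState (honestState a 0 k b b') =
        pureState fun p : ((Fin k → Fin 2) × Unit) × ((Fin k → Fin 2) × Unit) =>
          psi a k (p.1.1, p.2.1) := by
      congr 1
      ext p
      change _ * ((1 : ℂ) * 1) = _
      rw [one_mul, mul_one]
    constructor
    · refine Eq.trans ?_ (run_finish a k true false x y)
      exact congrArg (fun σ => run _ (aliceFinish a k true) (bobFinish a k false) σ x y)
        (h true false)
    · refine Eq.trans ?_ (run_finish a k false true x y)
      exact congrArg (fun σ => run _ (aliceFinish a k false) (bobFinish a k true) σ x y)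
        (h false true)
  | succ j ih =>
    obtain ⟨ih1, ih2⟩ := ih (k + 1) (by omega)
    constructor
    · refine (run_send_recv rfl _ _ _ _ _ _ x y).trans (Eq.trans ?_ ih2)
      refine congrArg (fun σ => run _ _ _ σ x y) ?_
      refine (left_sends_qubit (β := unsent j false) (γ := unsent j true) _ (fun _ => rfl) _
        (fun _ => rfl) _).trans (congrArg pureState ?_)
      ext p
      change psi a k _ * ((phi _ _ * unsentState a j false (k + 1) p.1.2) *
        unsentState a j true (k + 1) p.2.2) = psi a (k + 1) _ * _
      rw [psi_succ]
      ring
    · refine (run_recv_send _ _ _ rfl _ _ _ x y).trans (Eq.trans ?_ ih1)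
      refine congrArg (fun σ => run _ _ _ σ x y) ?_
      refine (right_sends_qubit (β := unsent j false) (γ := unsent j true) _ (fun _ => rfl) _
        (fun _ => rfl) _).trans (congrArg pureState ?_)
      ext p
      change psi a k _ * (unsentState a j true (k + 1) p.1.2 *
        (phi _ _ * unsentState a j false (k + 1) p.2.2)) = psi a (k + 1) _ * _
      rw [psi_succ, phi_comm]
      ring

theorem outcomeProb_protocol (n : ℕ) (a : ℕ → unitInterval) (x y : Player) :
    outcomeProb (protocol n a).alice (protocol n a).bob x y =
      if x = y then winProb a x n else 0 := by
  refine Eq.trans ?_ (run_exchange a n x y n 0 (zero_add n)).1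
  refine congrArg (fun σ => run _ _ _ σ x y) ?_
  ext p q
  change (unsentState a n true 0 _ * star (unsentState a n true 0 _)) *
    (unsentState a n false 0 _ * star (unsentState a n false 0 _)) =
    (∏ i : Fin 0, _) * (unsentState a n true 0 _ * unsentState a n false 0 _) *
      star ((∏ i : Fin 0, _) * (unsentState a n true 0 _ * unsentState a n false 0 _))
  simp only [Finset.univ_eq_empty, Finset.prod_empty, one_mul, star_mul']
  ring

/-! ### Honest winning probabilities -/

theorem winProb_zero (a : ℕ → unitInterval) (w : Player) :
    winProb a w 0 = if w = .alice then 1 else 0 := by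
  cases w <;> simp [winProb, stringProb, E, winner]

theorem E_snoc_zero (w : Player) (n : ℕ) (x : Fin n → Fin 2) :
    E w (n + 1) (Fin.snoc x 0) = if (sender (n + 1)).other = w then 1 else 0 := by
  simp [E, winner]

theorem E_snoc_one (w : Player) (n : ℕ) (x : Fin n → Fin 2) :
    E w (n + 1) (Fin.snoc x 1) = E w n x := by
  simp [E, winner]

theorem sum_stringProb (a : ℕ → unitInterval) (n : ℕ) : ∑ x, stringProb a n x = 1 := by
  induction n with
  | zero => simp [stringProb]
  | succ n ih =>
    rw [sum_snoc, ← ih]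
    refine Finset.sum_congr rfl fun x _ => ?_
    simp only [stringProb_snoc, bitProb, Matrix.cons_val_zero, Matrix.cons_val_one]
    ring

/-- A zero in the last qubit decides against its sender; a one leaves the decision to the earlier
qubits. -/
theorem winProb_succ (a : ℕ → unitInterval) (w : Player) (n : ℕ) :
    winProb a w (n + 1) = (if (sender (n + 1)).other = w then (a (n + 1) : ℝ) else 0) +
      (1 - a (n + 1)) * winProb a w n := by
  have h : (if (sender (n + 1)).other = w then (a (n + 1) : ℝ) else 0) =
      ∑ x, (if (sender (n + 1)).other = w then (a (n + 1) : ℝ) else 0) * stringProb a n x := by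
    rw [← Finset.mul_sum, sum_stringProb, mul_one]
  rw [h, winProb, winProb, sum_snoc, Finset.mul_sum, ← Finset.sum_add_distrib]
  refine Finset.sum_congr rfl fun x _ => ?_
  simp only [E_snoc_zero, E_snoc_one, stringProb_snoc, bitProb, Matrix.cons_val_zero,
    Matrix.cons_val_one]
  split_ifs <;> ring

theorem winProb_alice_add_bob (a : ℕ → unitInterval) (n : ℕ) :
    winProb a .alice n + winProb a .bob n = 1 := by
  rw [winProb, winProb, ← Finset.sum_add_distrib, ← sum_stringProb a n]
  refine Finset.sum_congr rfl fun x _ => ?_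
  unfold E
  cases winner n x <;> simp

/-- The protocol has the claimed properties as soon as Alice wins with probability one half. -/
theorem achieves_of_winProb {n : ℕ} {a : ℕ → unitInterval} (h : winProb a .alice n = 1 / 2)
    {ε δ : ℝ} (hε : |max (boundAlice n a) (boundBob n a) - 1 / 2 - ε| ≤ δ) :
    Achieves n a ε δ := by
  have h' : winProb a .bob n = 1 / 2 := by linarith [winProb_alice_add_bob a n]
  refine ⟨length_messagesFrom _ _ _ _, fun x y => ?_, ?_, ?_, hε⟩
  · rw [outcomeProb_protocol]
    cases x <;> simp [h, h']
  · refine (cheatAlice_le n a).trans_eq ?_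
    rw [h, boundAlice]
    norm_num
  · refine (cheatBob_le n a).trans_eq ?_
    rw [h', boundBob]
    norm_num

theorem Achieves.bias_le {n : ℕ} {a : ℕ → unitInterval} {ε δ : ℝ} (h : Achieves n a ε δ) :
    (protocol n a).bias ≤ ε + δ := by
  obtain ⟨-, -, hA, hB, hε⟩ := h
  have := (abs_le.1 hε).2
  have := max_le_max hA hB
  unfold Protocol.bias
  linarith

/-! ### Evaluation of the bounds

The diagonals that occur in the bounds depend on a bit string only through the winner. -/

/-- The diagonal with entry `u` where Alice wins and `v` where Bob wins. -/
def byWinner (n : ℕ) (u v : ℝ) (x : Fin n → Fin 2) : ℝ := if winner n x = .alice then u else v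

theorem E_alice_eq_byWinner (n : ℕ) : E .alice n = byWinner n 1 0 := by
  ext x
  simp [E, byWinner]

theorem E_bob_eq_byWinner (n : ℕ) : E .bob n = byWinner n 0 1 := by
  ext x
  cases h : winner n x <;> simp [E, byWinner, h]

theorem byWinner_snoc_zero (n : ℕ) (u v : ℝ) (x : Fin n → Fin 2) :
    byWinner (n + 1) u v (Fin.snoc x 0) = if sender (n + 1) = .alice then v else u := by
  cases h : sender (n + 1) <;> simp [byWinner, winner, h, Player.other]

theorem byWinner_snoc_one (n : ℕ) (u v : ℝ) (x : Fin n → Fin 2) :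
    byWinner (n + 1) u v (Fin.snoc x 1) = byWinner n u v x := by
  simp [byWinner, winner]

/-- A last qubit equal to 0 makes the opponent of its sender win. Strings already won by that
opponent average two equal entries, so only the entry of the sender changes. -/
theorem traceLast_byWinner (a : ℝ) (n : ℕ) (u v : ℝ) :
    traceLast a (byWinner (n + 1) u v) = if sender (n + 1) = .alice
      then byWinner n (a * v + (1 - a) * u) v else byWinner n u (a * u + (1 - a) * v) := by
  ext x
  rw [traceLast, byWinner_snoc_zero, byWinner_snoc_one]
  split_ifs <;> simp only [byWinner] <;> split_ifs <;> ring

theorem rmsLast_byWinner (a : ℝ) (n : ℕ) {u v : ℝ} (hu : 0 ≤ u) (hv : 0 ≤ v) :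
    rmsLast a (byWinner (n + 1) u v) = if sender (n + 1) = .alice
      then byWinner n (√(a * v ^ 2 + (1 - a) * u ^ 2)) v
      else byWinner n u (√(a * u ^ 2 + (1 - a) * v ^ 2)) := by
  have h (z : ℝ) (hz : 0 ≤ z) : √(a * z ^ 2 + (1 - a) * z ^ 2) = z := by
    rw [← add_mul, add_sub_cancel, one_mul, Real.sqrt_sq hz]
  ext x
  rw [rmsLast, byWinner_snoc_zero, byWinner_snoc_one]
  split_ifs <;> simp only [byWinner] <;> split_ifs <;> simp [h, hu, hv]

/-- The nested operation takes values in `[L, R]` on the diagonals whose two entries are in the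
intervals `[u, u']` and `[v, v']`. -/
def NestedMem (a : ℕ → unitInterval) (h : Player) (n : ℕ) (u u' v v' L R : ℝ) : Prop :=
  ∀ s t, u ≤ s → s ≤ u' → v ≤ t → t ≤ v' →
    L ≤ nested a h n (byWinner n s t) ∧ nested a h n (byWinner n s t) ≤ R

namespace NestedMem

variable {a : ℕ → unitInterval} {n : ℕ} {u u' v v' L R : ℝ}

/-- Without qubits Alice is the winner, so her entry is the value. -/
theorem zero (h : Player) : NestedMem a h 0 u u' v v' u u' := fun _ _ h1 h2 _ _ => ⟨h1, h2⟩

theorem trace_le {x p p' q q' s t lo hi : ℝ} (hx : 0 ≤ x) (hx' : x ≤ 1) (hp : p ≤ s) (hp' : s ≤ p')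
    (hq : q ≤ t) (hq' : t ≤ q') (hlo : lo ≤ x * p + (1 - x) * q)
    (hhi : x * p' + (1 - x) * q' ≤ hi) :
    lo ≤ x * s + (1 - x) * t ∧ x * s + (1 - x) * t ≤ hi := by
  have h1 : 0 ≤ 1 - x := sub_nonneg.2 hx'
  exact ⟨hlo.trans (by gcongr), le_trans (by gcongr) hhi⟩

/-- The enclosure is certified through squares, which leaves only rational inequalities to check. -/
theorem rms_le {x p p' q q' s t lo hi : ℝ} (hx : 0 ≤ x) (hx' : x ≤ 1) (hp0 : 0 ≤ p) (hq0 : 0 ≤ q)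
    (hp : p ≤ s) (hp' : s ≤ p') (hq : q ≤ t) (hq' : t ≤ q')
    (hlo : lo ^ 2 ≤ x * p ^ 2 + (1 - x) * q ^ 2) (hhi0 : 0 ≤ hi)
    (hhi : x * p' ^ 2 + (1 - x) * q' ^ 2 ≤ hi ^ 2) :
    lo ≤ √(x * s ^ 2 + (1 - x) * t ^ 2) ∧ √(x * s ^ 2 + (1 - x) * t ^ 2) ≤ hi := by
  have h1 : 0 ≤ 1 - x := sub_nonneg.2 hx'
  have hs := hp0.trans hp
  have ht := hq0.trans hq
  exact ⟨Real.le_sqrt_of_sq_le (hlo.trans (by gcongr)),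
    Real.sqrt_le_iff.2 ⟨hhi0, le_trans (by gcongr) hhi⟩⟩

/-- This and the three rules below are interval steps eliminating the last qubit; `lo` and `hi`
enclose the one entry that changes. -/
theorem alice_trace {x : ℝ} (lo hi : ℝ) (hs : sender (n + 1) = .alice) (hx : a (n + 1) = x)
    (h : lo ≤ x * v + (1 - x) * u ∧ x * v' + (1 - x) * u' ≤ hi)
    (next : NestedMem a .alice n lo hi v v' L R) :
    NestedMem a .alice (n + 1) u u' v v' L R := by
  subst hx
  intro s t h1 h2 h3 h4
  rw [nested, if_pos hs, traceLast_byWinner, if_pos hs]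
  have := trace_le (a (n + 1)).2.1 (a (n + 1)).2.2 h3 h4 h1 h2 h.1 h.2
  exact next _ _ this.1 this.2 h3 h4

theorem bob_trace {x : ℝ} (lo hi : ℝ) (hs : sender (n + 1) = .bob) (hx : a (n + 1) = x)
    (h : lo ≤ x * u + (1 - x) * v ∧ x * u' + (1 - x) * v' ≤ hi)
    (next : NestedMem a .bob n u u' lo hi L R) :
    NestedMem a .bob (n + 1) u u' v v' L R := by
  subst hx
  intro s t h1 h2 h3 h4
  rw [nested, if_pos hs, traceLast_byWinner, if_neg (by rw [hs]; decide)]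
  have := trace_le (a (n + 1)).2.1 (a (n + 1)).2.2 h1 h2 h3 h4 h.1 h.2
  exact next _ _ h1 h2 this.1 this.2

theorem alice_rms {x : ℝ} (lo hi : ℝ) (hs : sender (n + 1) = .alice) (hx : a (n + 1) = x)
    (h : 0 ≤ u ∧ 0 ≤ v ∧ 0 ≤ hi ∧ lo ^ 2 ≤ x * v ^ 2 + (1 - x) * u ^ 2 ∧
      x * v' ^ 2 + (1 - x) * u' ^ 2 ≤ hi ^ 2)
    (next : NestedMem a .bob n lo hi v v' L R) :
    NestedMem a .bob (n + 1) u u' v v' L R := by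
  subst hx
  obtain ⟨hu, hv, hhi, hl, hr⟩ := h
  intro s t h1 h2 h3 h4
  rw [nested, if_neg (by rw [hs]; decide), rmsLast_byWinner _ _ (hu.trans h1) (hv.trans h3),
    if_pos hs]
  have := rms_le (a (n + 1)).2.1 (a (n + 1)).2.2 hv hu h3 h4 h1 h2 hl hhi hr
  exact next _ _ this.1 this.2 h3 h4

theorem bob_rms {x : ℝ} (lo hi : ℝ) (hs : sender (n + 1) = .bob) (hx : a (n + 1) = x)
    (h : 0 ≤ u ∧ 0 ≤ v ∧ 0 ≤ hi ∧ lo ^ 2 ≤ x * u ^ 2 + (1 - x) * v ^ 2 ∧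
      x * u' ^ 2 + (1 - x) * v' ^ 2 ≤ hi ^ 2)
    (next : NestedMem a .alice n u u' lo hi L R) :
    NestedMem a .alice (n + 1) u u' v v' L R := by
  subst hx
  obtain ⟨hu, hv, hhi, hl, hr⟩ := h
  intro s t h1 h2 h3 h4
  rw [nested, if_neg (by rw [hs]; decide), rmsLast_byWinner _ _ (hu.trans h1) (hv.trans h3),
    if_neg (by rw [hs]; decide)]
  have := rms_le (a (n + 1)).2.1 (a (n + 1)).2.2 hu hv h1 h2 h3 h4 hl hhi hr
  exact next _ _ h1 h2 this.1 this.2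

theorem boundAlice_mem (h : NestedMem a .bob n 1 1 0 0 L R) (hL : 0 ≤ L) :
    2 * L ^ 2 ≤ boundAlice n a ∧ boundAlice n a ≤ 2 * R ^ 2 := by
  obtain ⟨h1, h2⟩ := h 1 0 le_rfl le_rfl le_rfl le_rfl
  rw [boundAlice, E_alice_eq_byWinner]
  have := hL.trans h1
  constructor <;> gcongr

theorem boundBob_mem (h : NestedMem a .alice n 0 0 1 1 L R) (hL : 0 ≤ L) :
    2 * L ^ 2 ≤ boundBob n a ∧ boundBob n a ≤ 2 * R ^ 2 := by
  obtain ⟨h1, h2⟩ := h 0 1 le_rfl le_rfl le_rfl le_rfl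
  rw [boundBob, E_bob_eq_byWinner]
  have := hL.trans h1
  constructor <;> gcongr

end NestedMem

/-! ### Explicit parameters and numerical enclosures -/

theorem exists_params (l : List ℝ) (hl : ∀ x ∈ l, 0 ≤ x ∧ x ≤ 1) :
    ∃ a : ℕ → unitInterval, ∀ k (hk : k < l.length), (a (k + 1) : ℝ) = l[k] := by
  refine ⟨fun k => if hk : k - 1 < l.length then ⟨l[k - 1], hl _ (List.getElem_mem hk)⟩ else 0,
    fun k hk => ?_⟩
  simp [hk]

theorem winProb_alice_odd (a : ℕ → unitInterval) {n : ℕ} {x q : ℝ} (hs : sender (n + 1) = .alice)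
    (hx : a (n + 1) = x) (h : winProb a .alice n = q) :
    winProb a .alice (n + 1) = (1 - x) * q := by
  rw [winProb_succ, hs, hx, h]
  simp [Player.other]

theorem winProb_alice_even (a : ℕ → unitInterval) {n : ℕ} {x q : ℝ} (hs : sender (n + 1) = .bob)
    (hx : a (n + 1) = x) (h : winProb a .alice n = q) :
    winProb a .alice (n + 1) = x + (1 - x) * q := by
  rw [winProb_succ, hs, hx, h]
  simp [Player.other]

theorem abs_max_sub_le {α β ε δ : ℝ} (hα : α ≤ 1 / 2 + ε + δ) (hβ : β ≤ 1 / 2 + ε + δ)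
    (h : 1 / 2 + ε - δ ≤ α ∨ 1 / 2 + ε - δ ≤ β) : |max α β - 1 / 2 - ε| ≤ δ := by
  have h1 : max α β ≤ 1 / 2 + ε + δ := max_le hα hβ
  have h2 : 1 / 2 + ε - δ ≤ max α β := le_max_iff.2 h
  rw [abs_le]
  constructor <;> linarith

theorem exists_params_three : ∃ a : ℕ → unitInterval,
      |(a 1 : ℝ) - 0.74094| ≤ 1e-6 ∧ |(a 2 : ℝ) - 0.479696| ≤ 1e-6 ∧
      |(a 3 : ℝ) - 0.186312| ≤ 1e-6 ∧
      winProb a .alice 3 = 1 / 2 ∧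
      (0.699045 ≤ boundAlice 3 a ∧ boundAlice 3 a ≤ 0.699055) ∧
      (0.699045 ≤ boundBob 3 a ∧ boundBob 3 a ≤ 0.699055) := by
  -- Fairness reads `(1 - a 3) (1 - (1 - a 2) a 1) = 1 / 2`; the first entry is its exact solution
  -- for the two given decimals. The interval endpoints below bracket the successive entries to
  -- about ten decimals.
  obtain ⟨a, ha⟩ := exists_params
    [2450687500 / 3307540009,
      0.479696, 0.186312]
    (by simp only [List.forall_mem_cons]; norm_num)
  have h1 : (a 1 : ℝ) = 2450687500 / 3307540009 := ha 0 (by simp)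
  have h2 : (a 2 : ℝ) = 0.479696 := ha 1 (by simp)
  have h3 : (a 3 : ℝ) = 0.186312 := ha 2 (by simp)
  have hα := NestedMem.boundAlice_mem (L := 0.5912064961) (R := 0.5912064963) (a := a) (n := 3) (
    .alice_rms 0.9020465619 0.902046562 (by decide) h3 (by norm_num) <|
    .bob_trace 0.4327081275 0.4327081277 (by decide) h2 (by norm_num) <|
    .alice_rms 0.5912064961 0.5912064963 (by decide) h1 (by norm_num) <|
    .zero _) (by norm_num)
  have hβ := NestedMem.boundBob_mem (L := 0.5912061181) (R := 0.5912061183) (a := a) (n := 3) (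
    .alice_trace 0.186312 0.186312 (by decide) h3 (by norm_num) <|
    .bob_rms 0.7327723281 0.7327723282 (by decide) h2 (by norm_num) <|
    .alice_trace 0.5912061181 0.5912061183 (by decide) h1 (by norm_num) <|
    .zero _) (by norm_num)
  norm_num at hα hβ
  have hw := (winProb_alice_odd a (by decide) h3
    (winProb_alice_even a (by decide) h2
    (winProb_alice_odd a (by decide) h1 (winProb_zero a .alice)))).trans
    (show _ = (1 / 2 : ℝ) by norm_num)
  refine ⟨a, ?_, ?_, ?_, hw, ⟨by linarith [hα.1], by linarith [hα.2]⟩,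
    by linarith [hβ.1], by linarith [hβ.2]⟩
  all_goals first | rw [h1, abs_le] | rw [h2, abs_le] | rw [h3, abs_le]
  all_goals norm_num

theorem exists_params_four : ∃ a : ℕ → unitInterval,
    winProb a .alice 4 = 1 / 2 ∧
      0.69565 ≤ boundAlice 4 a ∧ boundAlice 4 a ≤ 0.69575 ∧ boundBob 4 a ≤ 0.69575 := by
  obtain ⟨a, ha⟩ := exists_params
    [100905050900000 / 145828136689917,
      0.46287, 0.35449, 0.15882]
    (by simp only [List.forall_mem_cons]; norm_num)
  have h1 : (a 1 : ℝ) = 100905050900000 / 145828136689917 := ha 0 (by simp)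
  have h2 : (a 2 : ℝ) = 0.46287 := ha 1 (by simp)
  have h3 : (a 3 : ℝ) = 0.35449 := ha 2 (by simp)
  have h4 : (a 4 : ℝ) = 0.15882 := ha 3 (by simp)
  have hα := NestedMem.boundAlice_mem (L := 0.5898051838) (R := 0.5898051839) (a := a) (n := 4) (
    .bob_trace 0.15882 0.15882 (by decide) h4 (by norm_num) <|
    .alice_rms 0.8089818181 0.8089818182 (by decide) h3 (by norm_num) <|
    .bob_trace 0.4597604007 0.4597604008 (by decide) h2 (by norm_num) <|
    .alice_rms 0.5898051838 0.5898051839 (by decide) h1 (by norm_num) <|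
    .zero _) (by norm_num)
  have hβ := NestedMem.boundBob_mem (L := 0.5898021795) (R := 0.5898021798) (a := a) (n := 4) (
    .bob_rms 0.9171586558 0.9171586559 (by decide) h4 (by norm_num) <|
    .alice_trace 0.3251235718 0.325123572 (by decide) h3 (by norm_num) <|
    .bob_rms 0.7076375079 0.7076375081 (by decide) h2 (by norm_num) <|
    .alice_trace 0.5898021795 0.5898021798 (by decide) h1 (by norm_num) <|
    .zero _) (by norm_num)
  norm_num at hα hβ
  have hw := (winProb_alice_even a (by decide) h4
    (winProb_alice_odd a (by decide) h3
    (winProb_alice_even a (by decide) h2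
    (winProb_alice_odd a (by decide) h1 (winProb_zero a .alice))))).trans
    (show _ = (1 / 2 : ℝ) by norm_num)
  refine ⟨a, hw, by linarith [hα.1], by linarith [hα.2], by linarith [hβ.2]⟩

theorem exists_params_six : ∃ a : ℕ → unitInterval,
    winProb a .alice 6 = 1 / 2 ∧
      0.69365 ≤ boundAlice 6 a ∧ boundAlice 6 a ≤ 0.69375 ∧ boundBob 6 a ≤ 0.69375 := by
  obtain ⟨a, ha⟩ := exists_params
    [39017666661106231771750000 / 56984562357898788268462707,
      0.442956, 0.334695, 0.276582, 0.23631, 0.109384]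
    (by simp only [List.forall_mem_cons]; norm_num)
  have h1 : (a 1 : ℝ) = 39017666661106231771750000 / 56984562357898788268462707 := ha 0 (by simp)
  have h2 : (a 2 : ℝ) = 0.442956 := ha 1 (by simp)
  have h3 : (a 3 : ℝ) = 0.334695 := ha 2 (by simp)
  have h4 : (a 4 : ℝ) = 0.276582 := ha 3 (by simp)
  have h5 : (a 5 : ℝ) = 0.23631 := ha 4 (by simp)
  have h6 : (a 6 : ℝ) = 0.109384 := ha 5 (by simp)
  have hα := NestedMem.boundAlice_mem (L := 0.5889604214) (R := 0.5889604217) (a := a) (n := 6) (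
    .bob_trace 0.109384 0.109384 (by decide) h6 (by norm_num) <|
    .alice_rms 0.8755098034 0.8755098035 (by decide) h5 (by norm_num) <|
    .bob_trace 0.3212806069 0.321280607 (by decide) h4 (by norm_num) <|
    .alice_rms 0.7379129341 0.7379129343 (by decide) h3 (by norm_num) <|
    .bob_trace 0.505830396 0.5058303962 (by decide) h2 (by norm_num) <|
    .alice_rms 0.5889604214 0.5889604217 (by decide) h1 (by norm_num) <|
    .zero _) (by norm_num)
  have hβ := NestedMem.boundBob_mem (L := 0.5889601483) (R := 0.5889601486) (a := a) (n := 6) (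
    .bob_rms 0.943724536 0.9437245361 (by decide) h6 (by norm_num) <|
    .alice_trace 0.2230115451 0.2230115452 (by decide) h5 (by norm_num) <|
    .bob_rms 0.811198629 0.8111986292 (by decide) h4 (by norm_num) <|
    .alice_trace 0.4198748211 0.4198748213 (by decide) h3 (by norm_num) <|
    .bob_rms 0.6668207356 0.6668207358 (by decide) h2 (by norm_num) <|
    .alice_trace 0.5889601483 0.5889601486 (by decide) h1 (by norm_num) <|
    .zero _) (by norm_num)
  norm_num at hα hβ
  have hw := (winProb_alice_even a (by decide) h6
    (winProb_alice_odd a (by decide) h5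
    (winProb_alice_even a (by decide) h4
    (winProb_alice_odd a (by decide) h3
    (winProb_alice_even a (by decide) h2
    (winProb_alice_odd a (by decide) h1 (winProb_zero a .alice))))))).trans
    (show _ = (1 / 2 : ℝ) by norm_num)
  refine ⟨a, hw, by linarith [hα.1], by linarith [hα.2], by linarith [hβ.2]⟩

theorem exists_params_eight : ∃ a : ℕ → unitInterval,
      |(a 1 : ℝ) - 0.680706| ≤ 1e-6 ∧ |(a 2 : ℝ) - 0.43281| ≤ 1e-6 ∧
      |(a 3 : ℝ) - 0.323787| ≤ 1e-6 ∧ |(a 4 : ℝ) - 0.264123| ≤ 1e-6 ∧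
      |(a 5 : ℝ) - 0.224377| ≤ 1e-6 ∧ |(a 6 : ℝ) - 0.197997| ≤ 1e-6 ∧
      |(a 7 : ℝ) - 0.177191| ≤ 1e-6 ∧ |(a 8 : ℝ) - 0.0834815| ≤ 1e-6 ∧
      winProb a .alice 8 = 1 / 2 ∧
      0.69305 ≤ boundAlice 8 a ∧ boundAlice 8 a ≤ 0.69315 ∧ boundBob 8 a ≤ 0.69315 := by
  -- The last seven parameters are moved by `1e-7` in Bob's favour, even ones down and odd ones up.
  -- With the unshifted decimals the value of `a 1` forced by fairness would miss its window of
  -- width `1e-6`.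
  obtain ⟨a, ha⟩ := exists_params
    [450623499590207706453686399321359896196570000000 /
        661994405898796708377957586447253497273052157957,
      0.4328099, 0.3237871, 0.2641229, 0.2243771, 0.1979969, 0.1771911, 0.0834814]
    (by simp only [List.forall_mem_cons]; norm_num)
  have h1 : (a 1 : ℝ) =
      450623499590207706453686399321359896196570000000 /
        661994405898796708377957586447253497273052157957 := ha 0 (by simp)
  have h2 : (a 2 : ℝ) = 0.4328099 := ha 1 (by simp)
  have h3 : (a 3 : ℝ) = 0.3237871 := ha 2 (by simp)
  have h4 : (a 4 : ℝ) = 0.2641229 := ha 3 (by simp)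
  have h5 : (a 5 : ℝ) = 0.2243771 := ha 4 (by simp)
  have h6 : (a 6 : ℝ) = 0.1979969 := ha 5 (by simp)
  have h7 : (a 7 : ℝ) = 0.1771911 := ha 6 (by simp)
  have h8 : (a 8 : ℝ) = 0.0834814 := ha 7 (by simp)
  have hα := NestedMem.boundAlice_mem (L := 0.5886681951) (R := 0.5886681956) (a := a) (n := 8) (
    .bob_trace 0.0834814 0.0834814 (by decide) h8 (by norm_num) <|
    .alice_rms 0.9077685664 0.9077685665 (by decide) h7 (by norm_num) <|
    .bob_trace 0.2466877036 0.2466877037 (by decide) h6 (by norm_num) <|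
    .alice_rms 0.8079614145 0.8079614147 (by decide) h5 (by norm_num) <|
    .bob_trace 0.3949329438 0.394932944 (by decide) h4 (by norm_num) <|
    .alice_rms 0.7013805146 0.7013805149 (by decide) h3 (by norm_num) <|
    .bob_trace 0.5275664862 0.5275664866 (by decide) h2 (by norm_num) <|
    .alice_rms 0.5886681951 0.5886681956 (by decide) h1 (by norm_num) <|
    .zero _) (by norm_num)
  have hβ := NestedMem.boundBob_mem (L := 0.5886681296) (R := 0.58866813) (a := a) (n := 8) (
    .bob_rms 0.9573497793 0.9573497794 (by decide) h8 (by norm_num) <|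
    .alice_trace 0.1696338604 0.1696338605 (by decide) h7 (by norm_num) <|
    .bob_rms 0.8606673266 0.8606673268 (by decide) h6 (by norm_num) <|
    .alice_trace 0.3246859455 0.3246859457 (by decide) h5 (by norm_num) <|
    .bob_rms 0.7569304871 0.7569304874 (by decide) h4 (by norm_num) <|
    .alice_trace 0.4646411521 0.4646411524 (by decide) h3 (by norm_num) <|
    .bob_rms 0.6468446221 0.6468446225 (by decide) h2 (by norm_num) <|
    .alice_trace 0.5886681296 0.58866813 (by decide) h1 (by norm_num) <|
    .zero _) (by norm_num)
  norm_num at hα hβ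
  have hw := (winProb_alice_even a (by decide) h8
    (winProb_alice_odd a (by decide) h7
    (winProb_alice_even a (by decide) h6
    (winProb_alice_odd a (by decide) h5
    (winProb_alice_even a (by decide) h4
    (winProb_alice_odd a (by decide) h3
    (winProb_alice_even a (by decide) h2
    (winProb_alice_odd a (by decide) h1 (winProb_zero a .alice))))))))).trans
    (show _ = (1 / 2 : ℝ) by norm_num)
  refine ⟨a, ?_, ?_, ?_, ?_, ?_, ?_, ?_, ?_, hw,
    by linarith [hα.1], by linarith [hα.2], by linarith [hβ.2]⟩
  all_goals first | rw [h1, abs_le] | rw [h2, abs_le] | rw [h3, abs_le] | rw [h4, abs_le] |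
    rw [h5, abs_le] | rw [h6, abs_le] | rw [h7, abs_le] | rw [h8, abs_le]
  all_goals norm_num

theorem exists_params_ten : ∃ a : ℕ → unitInterval,
    winProb a .alice 10 = 1 / 2 ∧
      0.69265 ≤ boundAlice 10 a ∧ boundAlice 10 a ≤ 0.69275 ∧ boundBob 10 a ≤ 0.69275 := by
  obtain ⟨a, ha⟩ := exists_params
    [55037870362115800781721144616258000 /
        81165924021190994335287405282348963,
      0.4265, 0.31684, 0.25638, 0.2168, 0.19, 0.16946, 0.15438, 0.1417, 0.06751]
    (by simp only [List.forall_mem_cons]; norm_num)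
  have h1 : (a 1 : ℝ) =
      55037870362115800781721144616258000 / 81165924021190994335287405282348963 := ha 0 (by simp)
  have h2 : (a 2 : ℝ) = 0.4265 := ha 1 (by simp)
  have h3 : (a 3 : ℝ) = 0.31684 := ha 2 (by simp)
  have h4 : (a 4 : ℝ) = 0.25638 := ha 3 (by simp)
  have h5 : (a 5 : ℝ) = 0.2168 := ha 4 (by simp)
  have h6 : (a 6 : ℝ) = 0.19 := ha 5 (by simp)
  have h7 : (a 7 : ℝ) = 0.16946 := ha 6 (by simp)
  have h8 : (a 8 : ℝ) = 0.15438 := ha 7 (by simp)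
  have h9 : (a 9 : ℝ) = 0.1417 := ha 8 (by simp)
  have h10 : (a 10 : ℝ) = 0.06751 := ha 9 (by simp)
  have hα := NestedMem.boundAlice_mem (L := 0.5885332699) (R := 0.5885332705) (a := a) (n := 10) (
    .bob_trace 0.06751 0.06751 (by decide) h10 (by norm_num) <|
    .alice_rms 0.9267932951 0.9267932952 (by decide) h9 (by norm_num) <|
    .bob_trace 0.200166155 0.2001661552 (by decide) h8 (by norm_num) <|
    .alice_rms 0.8486333259 0.8486333261 (by decide) h7 (by norm_num) <|
    .bob_trace 0.3233749174 0.3233749177 (by decide) h6 (by norm_num) <|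
    .alice_rms 0.7659731615 0.7659731618 (by decide) h5 (by norm_num) <|
    .bob_trace 0.4368482552 0.4368482556 (by decide) h4 (by norm_num) <|
    .alice_rms 0.6791794642 0.6791794646 (by decide) h3 (by norm_num) <|
    .bob_trace 0.5402025158 0.5402025163 (by decide) h2 (by norm_num) <|
    .alice_rms 0.5885332699 0.5885332705 (by decide) h1 (by norm_num) <|
    .zero _) (by norm_num)
  have hβ := NestedMem.boundBob_mem (L := 0.5885336892) (R := 0.5885336898) (a := a) (n := 10) (
    .bob_rms 0.9656552179 0.965655218 (by decide) h10 (by norm_num) <|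
    .alice_trace 0.1368333443 0.1368333444 (by decide) h9 (by norm_num) <|
    .bob_rms 0.8896194167 0.8896194169 (by decide) h8 (by norm_num) <|
    .alice_trace 0.2644004721 0.2644004723 (by decide) h7 (by norm_num) <|
    .bob_rms 0.80890966 0.8089096603 (by decide) h6 (by norm_num) <|
    .alice_trace 0.382450064 0.3824500643 (by decide) h5 (by norm_num) <|
    .bob_rms 0.7239314023 0.7239314027 (by decide) h4 (by norm_num) <|
    .alice_trace 0.4906450112 0.4906450116 (by decide) h3 (by norm_num) <|
    .bob_rms 0.6350042488 0.6350042493 (by decide) h2 (by norm_num) <|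
    .alice_trace 0.5885336892 0.5885336898 (by decide) h1 (by norm_num) <|
    .zero _) (by norm_num)
  norm_num at hα hβ
  have hw := (winProb_alice_even a (by decide) h10
    (winProb_alice_odd a (by decide) h9
    (winProb_alice_even a (by decide) h8
    (winProb_alice_odd a (by decide) h7
    (winProb_alice_even a (by decide) h6
    (winProb_alice_odd a (by decide) h5
    (winProb_alice_even a (by decide) h4
    (winProb_alice_odd a (by decide) h3
    (winProb_alice_even a (by decide) h2
    (winProb_alice_odd a (by decide) h1 (winProb_zero a .alice))))))))))).trans
    (show _ = (1 / 2 : ℝ) by norm_num)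
  refine ⟨a, hw, by linarith [hα.1], by linarith [hα.2], by linarith [hβ.2]⟩

end CoinFlip

end

theorem mainTheorem2 :
    -- protocols with a bias strictly below that of Spekkens and Rudolph exist
    (∃ P : CoinFlip.Protocol, P.IsFair ∧ P.bias < 1 / √2 - 1 / 2) ∧
    -- n = 3
    (∃ a : ℕ → unitInterval,
      |(a 1 : ℝ) - 0.74094| ≤ 1e-6 ∧ |(a 2 : ℝ) - 0.479696| ≤ 1e-6 ∧
      |(a 3 : ℝ) - 0.186312| ≤ 1e-6 ∧
      CoinFlip.Achieves 3 a 0.19905 5e-6 ∧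
      |CoinFlip.boundAlice 3 a - 0.69905| ≤ 5e-6 ∧ |CoinFlip.boundBob 3 a - 0.69905| ≤ 5e-6 ∧
      (CoinFlip.protocol 3 a).bias ≤ 0.1991) ∧
    -- n = 8
    (∃ a : ℕ → unitInterval,
      |(a 1 : ℝ) - 0.680706| ≤ 1e-6 ∧ |(a 2 : ℝ) - 0.43281| ≤ 1e-6 ∧
      |(a 3 : ℝ) - 0.323787| ≤ 1e-6 ∧ |(a 4 : ℝ) - 0.264123| ≤ 1e-6 ∧
      |(a 5 : ℝ) - 0.224377| ≤ 1e-6 ∧ |(a 6 : ℝ) - 0.197997| ≤ 1e-6 ∧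
      |(a 7 : ℝ) - 0.177191| ≤ 1e-6 ∧ |(a 8 : ℝ) - 0.0834815| ≤ 1e-6 ∧
      CoinFlip.Achieves 8 a 0.1931 5e-5 ∧ (CoinFlip.protocol 8 a).bias ≤ 0.19315) ∧
    -- n = 4, 6, 10
    (∃ a : ℕ → unitInterval,
      CoinFlip.Achieves 4 a 0.1957 5e-5 ∧ (CoinFlip.protocol 4 a).bias ≤ 0.19575) ∧
    (∃ a : ℕ → unitInterval,
      CoinFlip.Achieves 6 a 0.1937 5e-5 ∧ (CoinFlip.protocol 6 a).bias ≤ 0.19375) ∧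
    (∃ a : ℕ → unitInterval,
      CoinFlip.Achieves 10 a 0.1927 5e-5 ∧ (CoinFlip.protocol 10 a).bias ≤ 0.19275) := by
  have h3 : ∃ a : ℕ → unitInterval,
      |(a 1 : ℝ) - 0.74094| ≤ 1e-6 ∧ |(a 2 : ℝ) - 0.479696| ≤ 1e-6 ∧
      |(a 3 : ℝ) - 0.186312| ≤ 1e-6 ∧
      CoinFlip.Achieves 3 a 0.19905 5e-6 ∧
      |CoinFlip.boundAlice 3 a - 0.69905| ≤ 5e-6 ∧ |CoinFlip.boundBob 3 a - 0.69905| ≤ 5e-6 ∧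
      (CoinFlip.protocol 3 a).bias ≤ 0.1991 := by
    obtain ⟨a, h1, h2, h3, hw, ⟨hα, hα'⟩, hβ, hβ'⟩ := CoinFlip.exists_params_three
    have hA : CoinFlip.Achieves 3 a 0.19905 5e-6 :=
      CoinFlip.achieves_of_winProb hw (CoinFlip.abs_max_sub_le (by linarith) (by linarith)
        (.inl (by linarith)))
    refine ⟨a, h1, h2, h3, hA, ?_, ?_, hA.bias_le.trans (by norm_num)⟩
    all_goals
      rw [abs_le]
      constructor <;> linarith
  refine ⟨?_, h3, ?_, ?_, ?_, ?_⟩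
  · obtain ⟨a, -, -, -, hA, -, -, hb⟩ := h3
    refine ⟨_, hA.2.1, hb.trans_lt ?_⟩
    -- Three-qubit protocols suffice: `0.1991 < 0.7 - 1 / 2`.
    have h : (0.7 : ℝ) < 1 / √2 := by
      rw [lt_div_iff₀ (by positivity), ← lt_div_iff₀' (by norm_num), Real.sqrt_lt' (by norm_num)]
      norm_num
    linarith
  · obtain ⟨a, h1, h2, h3, h4, h5, h6, h7, h8, hw, hα, hα', hβ⟩ := CoinFlip.exists_params_eight
    have hA : CoinFlip.Achieves 8 a 0.1931 5e-5 :=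
      CoinFlip.achieves_of_winProb hw (CoinFlip.abs_max_sub_le (by linarith) (by linarith)
        (.inl (by linarith)))
    exact ⟨a, h1, h2, h3, h4, h5, h6, h7, h8, hA, hA.bias_le.trans (by norm_num)⟩
  · obtain ⟨a, hw, hα, hα', hβ⟩ := CoinFlip.exists_params_four
    have hA : CoinFlip.Achieves 4 a 0.1957 5e-5 :=
      CoinFlip.achieves_of_winProb hw (CoinFlip.abs_max_sub_le (by linarith) (by linarith)
        (.inl (by linarith)))
    exact ⟨a, hA, hA.bias_le.trans (by norm_num)⟩
  · obtain ⟨a, hw, hα, hα', hβ⟩ := CoinFlip.exists_params_six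
    have hA : CoinFlip.Achieves 6 a 0.1937 5e-5 :=
      CoinFlip.achieves_of_winProb hw (CoinFlip.abs_max_sub_le (by linarith) (by linarith)
        (.inl (by linarith)))
    exact ⟨a, hA, hA.bias_le.trans (by norm_num)⟩
  · obtain ⟨a, hw, hα, hα', hβ⟩ := CoinFlip.exists_params_ten
    have hA : CoinFlip.Achieves 10 a 0.1927 5e-5 :=
      CoinFlip.achieves_of_winProb hw (CoinFlip.abs_max_sub_le (by linarith) (by linarith)
        (.inl (by linarith)))
    exact ⟨a, hA, hA.bias_le.trans (by norm_num)⟩
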